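/- **Setting.** Let $(\mathcal S,\mathcal A,\mathcal B,H,\mathbb P,r)$ be a two-player zero-sum Markov game with finite action sets, horizon $H\ge 1$, transition kernels $\mathbb P_h(\cdot\mid x,a,b)$ and deterministic rewards $r_h(x,a,b)\in[0,1]$. The max-player uses policies $\pi=\{\pi_h(\cdot\mid x)\}$, the min-player $\nu=\{\nu_h(\cdot\mid x)\}$; $V_h^{\pi,\nu}(x)=\mathbb E_{\pi,\nu}[\sum_{h'=h}^H r_{h'}\mid x_h=x]$, $V_1^{*,\nu}=\sup_\pi V_1^{\pi,\nu}$, $V_1^{\pi,*}=\inf_\nu V_1^{\pi,\nu}$, $(\pi^*,\nu^*)$ is a Nash equilibrium (from every state, at every step), and $V_h^*=V_h^{\pi^*,\nu^*}$. The game is linear for a known feature map $\phi:\mathcal S\times\mathcal A\times\mathcal B\to\mathbb R^d$ with $\|\phi\|_2\le 1$: for each $h$ there are $\theta_h\in\mathbb R^d$ and a vector $\mu_h$ of $d$ signed measures on $\mathcal S$ with $\mathbb P_h(\cdot\mid x,a,b)=\langle\phi(x,a,b),\mu_h(\cdot)\rangle$, $r_h(x,a,b)=\langle\phi(x,a,b),\theta_h\rangle$,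 $\|\theta_h\|_2\le\sqrt d$ and $\|\mu_h(E)\|_2\le\sqrt d$ for all measurable $E\subseteq\mathcal S$. The dataset consists of $K\ge1$ independent trajectories of the game under a behavior policy $b$, from an initial distribution $\rho$. Let $\kappa=\min_h\lambda_{\min}\big(\mathbb E_b[\phi(x_h,a_h,b_h)\phi(x_h,a_h,b_h)^\top]\big)$. **SPMVI.** Split the trajectories, independently of the data, into $H$ folds $\mathcal D_1,\dots,\mathcal D_H$ of $K/H$ trajectories each. Put $\underline V_{H+1}=\overline V_{H+1}=0$ and, for $h=H,\dots,1$, with $\phi_h^\tau=\phi(x_h^\tau,a_h^\tau,b_h^\tau)$, $$\Lambda_h=\sum_{\tau\in\mathcal D_h}\phi_h^\tau(\phi_h^\tau)^\top+\lambda I,\quad \underline w_h=\Lambda_h^{-1}\sum_{\tau\in\mathcal D_h}\phi_h^\tau\big(r_h^\tau+\underline V_{h+1}(x_{h+1}^\tau)\big),\quad \overline w_h=\Lambda_h^{-1}\sum_{\tau\in\mathcal D_h}\phi_h^\tau\big(r_h^\tau+\overline V_{h+1}(x_{h+1}^\tau)\big),$$ $\Gamma_h=\beta\|\phi\|_{\Lambda_h^{-1}}$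 where $\|u\|_M=\sqrt{u^\top Mu}$, and let $\underline Q_h$, $\overline Q_h$ be $\phi^\top\underline w_h-\Gamma_h$ and $\phi^\top\overline w_h+\Gamma_h$ clipped to $[0,H-h+1]$. At each state $x$ let $(\widehat\pi_h,\nu_h')$ and $(\pi_h',\widehat\nu_h)$ be arbitrary Nash equilibria of the matrix games $\underline Q_h(x,\cdot,\cdot)$ and $\overline Q_h(x,\cdot,\cdot)$, and let $\underline V_h(x)$, $\overline V_h(x)$ be the corresponding equilibrium values. Output $(\widehat\pi,\widehat\nu)$. **Theorem.** There is an absolute constant $c_0>0$ such that for every $c\ge c_0$ there is a constant $C>0$, depending only on $c$, with the following property. For every game, feature map, behavior policy, initial distribution, equal splitting and Nash equilibrium $(\pi^*,\nu^*)$ as above and every $\delta\in(0,1)$, let $\iota=\log(2dHK/\delta)$ and run SPMVI with $\lambda=1$ and $\beta=c\sqrt d\,H\sqrt\iota$. Then with probability at least $1-\delta$, for all possible outcomes of the run (that is, all choices of the equilibria of the matrix games), the following two statements hold. 1. For all $x\in\mathcal S$, $$V_1^{*,\widehat\nu}(x)-V_1^{\widehat\pi,*}(x)\le C\sqrt d\,H\sqrt\iota\,\Big(\sup_\nu\sum_{h=1}^H\mathbb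 E_{\pi^*,\nu}\big[\|\phi(x_h,a_h,b_h)\|_{\Lambda_h^{-1}}\,\big|\,x_1=x\big]+\sup_\pi\sum_{h=1}^H\mathbb E_{\pi,\nu^*}\big[\|\phi(x_h,a_h,b_h)\|_{\Lambda_h^{-1}}\,\big|\,x_1=x\big]\Big),$$ where the expectations are over a fresh trajectory, for the given dataset. 2. If $\kappa>0$, then $$\sup_{h\in[H]}\|V_h^*-\overline V_h\|_\infty\le C\sqrt\iota\,\frac{H^{2.5}\sqrt d}{\sqrt{K\kappa}},\qquad \sup_{h\in[H]}\|V_h^*-\underline V_h\|_\infty\le C\sqrt\iota\,\frac{H^{2.5}\sqrt d}{\sqrt{K\kappa}}.$$ -/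

import Mathlib

open MeasureTheory ProbabilityTheory
open scoped BigOperators

noncomputable section

/-- A two-player zero-sum Markov game. Steps are numbered from `0`, so that step `h` here is step
`h + 1` in the usual numbering; in a game of horizon `H` only the steps `h < H` matter. -/
structure MarkovGame (S A B : Type*) [MeasurableSpace S] [MeasurableSpace A]
    [MeasurableSpace B] where
  /-- transition kernels -/
  P : ℕ → Kernel (S × A × B) S
  markov : ∀ h, IsMarkovKernel (P h)
  /-- deterministic rewards -/
  r : ℕ → S × A × B → ℝ
  measurable_r : ∀ h, Measurable (r h)
  r_mem : ∀ h z, r h z ∈ Set.Icc (0 : ℝ) 1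

instance {S A B : Type*} [MeasurableSpace S] [MeasurableSpace A] [MeasurableSpace B]
    (G : MarkovGame S A B) (h : ℕ) : IsMarkovKernel (G.P h) := G.markov h

/-- A Markov policy: at each step, a (measurable) map from states to distributions on actions. -/
structure Policy (S A : Type*) [MeasurableSpace S] [MeasurableSpace A] where
  kernel : ℕ → Kernel S A
  markov : ∀ h, IsMarkovKernel (kernel h)

instance {S A : Type*} [MeasurableSpace S] [MeasurableSpace A]
    (π : Policy S A) (h : ℕ) : IsMarkovKernel (π.kernel h) := π.markov h

/-- The probability `π_h(a | x)`. -/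
def Policy.prob {S A : Type*} [MeasurableSpace S] [MeasurableSpace A]
    (π : Policy S A) (h : ℕ) (x : S) (a : A) : ℝ := (π.kernel h x).real {a}

/-- The two players choose their actions independently given the state. -/
def Policy.joint {S A B : Type*} [MeasurableSpace S] [MeasurableSpace A] [MeasurableSpace B]
    (π : Policy S A) (ν : Policy S B) : Policy S (A × B) where
  kernel h := π.kernel h ×ₖ ν.kernel h
  markov _ := inferInstance

/-- A transition `((x_h, a_h, b_h), x_{h+1})`. -/
abbrev Transition (S A B : Type*) := (S × A × B) × S

/-- What the learner observes of a transition: `(x_h, a_h, b_h)`, the reward and `x_{h+1}`. -/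
structure Sample (S A B : Type*) where
  sa : S × A × B
  reward : ℝ
  next : S

section Game

variable {S A B : Type*} [MeasurableSpace S] [MeasurableSpace A] [MeasurableSpace B]

/-- Prepend the transition `((x, a, b), x')` to a trajectory. -/
def consTransition {n : ℕ} (q : S × (((A × B) × S) × (Fin n → Transition S A B))) :
    Fin (n + 1) → Transition S A B :=
  Fin.cons (α := fun _ => Transition S A B) ((q.1, q.2.1.1), q.2.1.2) q.2.2

theorem measurable_consTransition {n : ℕ} :
    Measurable (consTransition (S := S) (A := A) (B := B) (n := n)) := by
  refine measurable_pi_iff.mpr fun i => ?_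
  refine Fin.cases ?_ (fun j => ?_) i
  · simp only [consTransition, Fin.cons_zero]
    fun_prop
  · simp only [consTransition, Fin.cons_succ]
    fun_prop

/-- The law of the `n` transitions of steps `h, …, h + n - 1` when the state at step `h` is `x`,
the actions follow the joint policy `σ` and the states follow the kernels of the game. -/
def MarkovGame.traj (G : MarkovGame S A B) (σ : Policy S (A × B)) :
    (n : ℕ) → ℕ → Kernel S (Fin n → Transition S A B)
  | 0, _ => Kernel.const S (Measure.dirac Fin.elim0)
  | n + 1, h =>
      (Kernel.id ×ₖ ((σ.kernel h ⊗ₖ G.P h) ⊗ₖ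
        (G.traj σ n (h + 1)).comap (fun p : S × ((A × B) × S) => p.2.2)
          (measurable_snd.comp measurable_snd))).map consTransition

instance MarkovGame.isMarkovKernel_traj (G : MarkovGame S A B) (σ : Policy S (A × B)) (n h : ℕ) :
    IsMarkovKernel (G.traj σ n h) := by
  induction n generalizing h with
  | zero => unfold MarkovGame.traj; infer_instance
  | succ n ih =>
    unfold MarkovGame.traj
    have := ih (h + 1)
    exact Kernel.IsMarkovKernel.map _ measurable_consTransition

/-- The value function `V_h^{π,ν}(x)`: the expected sum of the rewards from step `h` on, given that
the state at step `h` is `x`. -/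
def MarkovGame.value (G : MarkovGame S A B) (H : ℕ) (π : Policy S A) (ν : Policy S B) (h : ℕ)
    (x : S) : ℝ :=
  ∫ ω, ∑ j : Fin (H - h), G.r (h + j) (ω j).1 ∂(G.traj (π.joint ν) (H - h) h x)

/-- `(π, ν)` is a Nash equilibrium: each policy is a best response to the other, from every state
and at every step. -/
def MarkovGame.IsNash (G : MarkovGame S A B) (H : ℕ) (π : Policy S A) (ν : Policy S B) : Prop :=
  ∀ h < H, ∀ x : S,
    (∀ π' : Policy S A, G.value H π' ν h x ≤ G.value H π ν h x) ∧
    (∀ ν' : Policy S B, G.value H π ν h x ≤ G.value H π ν' h x)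

/-- The duality gap `V_1^{*,ν}(x) - V_1^{π,*}(x)`. -/
def MarkovGame.gap (G : MarkovGame S A B) (H : ℕ) (π : Policy S A) (ν : Policy S B) (x : S) : ℝ :=
  (⨆ π' : Policy S A, G.value H π' ν 0 x) - (⨅ ν' : Policy S B, G.value H π ν' 0 x)

/-- The game of horizon `H` is linear in the feature map `φ`. The `d` signed measures of a step are
bundled into one vector measure with values in `ℝ^d`. -/
structure MarkovGame.IsLinear (G : MarkovGame S A B) (H : ℕ) {d : ℕ}
    (φ : S × A × B → EuclideanSpace ℝ (Fin d)) : Prop where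
  measurable : Measurable φ
  norm_le : ∀ z, ‖φ z‖ ≤ 1
  transition : ∀ h < H, ∃ μ : VectorMeasure S (EuclideanSpace ℝ (Fin d)),
    (∀ z E, MeasurableSet E → (G.P h z).real E = inner ℝ (φ z) (μ E)) ∧
    (∀ E, MeasurableSet E → ‖μ E‖ ≤ √d)
  reward : ∀ h < H, ∃ θ : EuclideanSpace ℝ (Fin d),
    (∀ z, G.r h z = inner ℝ (φ z) θ) ∧ ‖θ‖ ≤ √d

/-- The law of one trajectory of length `H` with initial distribution `ρ` and behavior policy
`b`. -/
def MarkovGame.trajLaw (G : MarkovGame S A B) (ρ : Measure S) (b : Policy S (A × B)) (H : ℕ) :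
    Measure (Fin H → Transition S A B) :=
  ρ.bind (G.traj b H 0)

/-- The law of `K` independent trajectories. -/
def MarkovGame.dataLaw (G : MarkovGame S A B) (ρ : Measure S) (b : Policy S (A × B)) (H K : ℕ) :
    Measure (Fin K → Fin H → Transition S A B) :=
  Measure.pi fun _ => G.trajLaw ρ b H

/-- The dataset seen by the learner, with its rewards. -/
def MarkovGame.observe (G : MarkovGame S A B) {H K : ℕ} (ω : Fin K → Fin H → Transition S A B) :
    Fin K → Fin H → Sample S A B :=
  fun τ h => ⟨(ω τ h).1, G.r h (ω τ h).1, (ω τ h).2⟩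

/-- The covariance matrix `𝔼[φ(x_h, a_h, b_h) φ(x_h, a_h, b_h)ᵀ]` under the behavior policy. -/
def MarkovGame.featureCov (G : MarkovGame S A B) (ρ : Measure S) (b : Policy S (A × B)) {H d : ℕ}
    (φ : S × A × B → EuclideanSpace ℝ (Fin d)) (h : Fin H) : Matrix (Fin d) (Fin d) ℝ :=
  Matrix.of fun i j => ∫ ω, φ (ω h).1 i * φ (ω h).1 j ∂(G.trajLaw ρ b H)

/-- The smallest (real) eigenvalue of a matrix. -/
def minEigenvalue {d : ℕ} (M : Matrix (Fin d) (Fin d) ℝ) : ℝ := sInf (spectrum ℝ M)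

/-- The coverage coefficient `κ = min_h λ_min(𝔼[φ φᵀ])`. -/
def MarkovGame.coverage (G : MarkovGame S A B) (ρ : Measure S) (b : Policy S (A × B)) (H : ℕ)
    {d : ℕ} (φ : S × A × B → EuclideanSpace ℝ (Fin d)) : ℝ :=
  ⨅ h : Fin H, minEigenvalue (G.featureCov ρ b φ h)

end Game

/-- The norm `‖u‖_M = √(uᵀ M u)`. -/
def matNorm {d : ℕ} (M : Matrix (Fin d) (Fin d) ℝ) (u : EuclideanSpace ℝ (Fin d)) : ℝ :=
  √(u.ofLp ⬝ᵥ M.mulVec u.ofLp)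

/-- The expected payoff of the matrix game `Q` under the mixed strategies `p` and `q`. -/
def payoff {A B : Type*} [Fintype A] [Fintype B] (Q : A → B → ℝ) (p : A → ℝ) (q : B → ℝ) : ℝ :=
  ∑ a, ∑ b, p a * q b * Q a b

/-- `(p, q)` is a Nash equilibrium of the zero-sum matrix game in which the first player maximizes
and the second one minimizes the payoff `Q`. -/
def IsMatrixNash {A B : Type*} [Fintype A] [Fintype B] (Q : A → B → ℝ) (p : A → ℝ) (q : B → ℝ) :
    Prop :=
  p ∈ stdSimplex ℝ A ∧ q ∈ stdSimplex ℝ B ∧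
    (∀ p' ∈ stdSimplex ℝ A, payoff Q p' q ≤ payoff Q p q) ∧
    (∀ q' ∈ stdSimplex ℝ B, payoff Q p q ≤ payoff Q p q')

section Algorithm

variable {S A B : Type*} {H K d : ℕ}

/-- The regularized Gram matrix `Λ_h`, built from the trajectories of the `h`-th fold only;
`fold τ` is the fold that trajectory `τ` is put in. -/
def gram (φ : S × A × B → EuclideanSpace ℝ (Fin d)) (fold : Fin K → Fin H) (lam : ℝ)
    (D : Fin K → Fin H → Sample S A B) (h : Fin H) : Matrix (Fin d) (Fin d) ℝ :=
  (∑ τ with fold τ = h, Matrix.vecMulVec (φ (D τ h).sa).ofLp (φ (D τ h).sa).ofLp) +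
    lam • (1 : Matrix (Fin d) (Fin d) ℝ)

/-- The ridge regression weights `Λ_h⁻¹ ∑_{τ ∈ D_h} φ_h^τ (r_h^τ + V(x_{h+1}^τ))`. -/
def ridge (φ : S × A × B → EuclideanSpace ℝ (Fin d)) (fold : Fin K → Fin H) (lam : ℝ)
    (D : Fin K → Fin H → Sample S A B) (h : Fin H) (V : S → ℝ) : Fin d → ℝ :=
  (gram φ fold lam D h)⁻¹.mulVec
    (∑ τ with fold τ = h, ((D τ h).reward + V (D τ h).next) • (φ (D τ h).sa).ofLp)

/-- The bonus `Γ_h = β ‖φ‖_{Λ_h⁻¹}`. -/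
def bonus (φ : S × A × B → EuclideanSpace ℝ (Fin d)) (fold : Fin K → Fin H) (lam β : ℝ)
    (D : Fin K → Fin H → Sample S A B) (h : Fin H) (z : S × A × B) : ℝ :=
  β * matNorm (gram φ fold lam D h)⁻¹ (φ z)

/-- The lower estimate of the Q-function at step `h`, given the estimate `V` of the value function
at the next step, clipped to `[0, H - h]` (`H - h` rewards remain as steps start at `0`). -/
def lowerQ (φ : S × A × B → EuclideanSpace ℝ (Fin d)) (fold : Fin K → Fin H) (lam β : ℝ)
    (D : Fin K → Fin H → Sample S A B) (h : Fin H) (V : S → ℝ) (z : S × A × B) : ℝ :=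
  max 0 (min ((φ z).ofLp ⬝ᵥ ridge φ fold lam D h V - bonus φ fold lam β D h z) ((H : ℝ) - h))

/-- The upper estimate of the Q-function. -/
def upperQ (φ : S × A × B → EuclideanSpace ℝ (Fin d)) (fold : Fin K → Fin H) (lam β : ℝ)
    (D : Fin K → Fin H → Sample S A B) (h : Fin H) (V : S → ℝ) (z : S × A × B) : ℝ :=
  max 0 (min ((φ z).ofLp ⬝ᵥ ridge φ fold lam D h V + bonus φ fold lam β D h z) ((H : ℝ) - h))

end Algorithm

/-- All that a run of SPMVI computes: the output pair `(πHat, νHat)`, the other halves `νAux`,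
`πAux` of the two equilibria, and the lower and upper estimates of the value functions. -/
structure SPMVIRun (S A B : Type*) [MeasurableSpace S] [MeasurableSpace A]
    [MeasurableSpace B] where
  πHat : Policy S A
  νAux : Policy S B
  πAux : Policy S A
  νHat : Policy S B
  loV : ℕ → S → ℝ
  upV : ℕ → S → ℝ

/-- `R` is a run of SPMVI on the dataset `D`, with the folds `fold`, ridge parameter `lam` and bonus
multiplier `β`; the equilibria of the matrix games may be any. -/
structure SPMVIRun.IsRunOn {S A B : Type*} [MeasurableSpace S] [MeasurableSpace A]
    [MeasurableSpace B] [Fintype A] [Fintype B] {H K d : ℕ} (R : SPMVIRun S A B)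
    (φ : S × A × B → EuclideanSpace ℝ (Fin d)) (fold : Fin K → Fin H) (lam β : ℝ)
    (D : Fin K → Fin H → Sample S A B) : Prop where
  loV_last : ∀ x, R.loV H x = 0
  upV_last : ∀ x, R.upV H x = 0
  lower_nash : ∀ (h : Fin H) (x : S),
    IsMatrixNash (fun a b => lowerQ φ fold lam β D h (R.loV (h + 1)) (x, a, b))
      (R.πHat.prob h x) (R.νAux.prob h x)
  upper_nash : ∀ (h : Fin H) (x : S),
    IsMatrixNash (fun a b => upperQ φ fold lam β D h (R.upV (h + 1)) (x, a, b))
      (R.πAux.prob h x) (R.νHat.prob h x)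
  loV_eq : ∀ (h : Fin H) (x : S), R.loV h x =
    payoff (fun a b => lowerQ φ fold lam β D h (R.loV (h + 1)) (x, a, b))
      (R.πHat.prob h x) (R.νAux.prob h x)
  upV_eq : ∀ (h : Fin H) (x : S), R.upV h x =
    payoff (fun a b => upperQ φ fold lam β D h (R.upV (h + 1)) (x, a, b))
      (R.πAux.prob h x) (R.νHat.prob h x)

/-- `∑_h 𝔼_{π,ν}[‖φ(x_h, a_h, b_h)‖_{Λ_h⁻¹} | x_1 = x]`. -/
def MarkovGame.uncertainty {S A B : Type*} [MeasurableSpace S] [MeasurableSpace A]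
    [MeasurableSpace B] (G : MarkovGame S A B) {H d : ℕ}
    (φ : S × A × B → EuclideanSpace ℝ (Fin d)) (Λ : Fin H → Matrix (Fin d) (Fin d) ℝ)
    (π : Policy S A) (ν : Policy S B) (x : S) : ℝ :=
  ∑ h : Fin H, ∫ ω, matNorm (Λ h)⁻¹ (φ (ω h).1) ∂(G.traj (π.joint ν) H 0 x)

/-- The common logarithm `log (2 d H K / δ)` behind the `Õ`-notation. -/
def logFactor (d H K : ℕ) (δ : ℝ) : ℝ := Real.log (2 * d * H * K / δ)

end

/-! Everything rests on one event: at every step, ridge regression predicts the Bellman backup `r_h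
+ P_h V` of the next value estimate `V` up to the bonus (`IsAccurate`). By linearity the backup is
`⟨φ, θ + w⟩` with `‖θ + w‖ ≤ √d H` (`exists_weight_of_linear`), so the prediction error is at most
`‖φ‖_{Λ⁻¹}` times the sum of a bias `√d H` and the `Λ⁻¹`-norm of the noise (`abs_ridge_error_le`).

The splitting makes the noise tractable. The estimate for step `h + 1` uses only later folds; given
the other folds and the features of fold `h`, it is a fixed function, and the noise terms are
independent, centred and bounded. With `Λ⁻¹ = Mᵀ M`, each coordinate of the whitened noise is a
weighted sum whose squared weights add up to at most `1`. Hoeffding and a union bound over `d`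
coordinates (`measure_matNorm_noise_le`) give `√d H √ι`, without a covering of a class of value
functions. The choice of equilibria is immaterial, because all equilibria of a matrix game have the
same value (`IsMatrixNash.payoff_eq`): one measurable estimate describes all runs
(`exists_measurable_estimate`).

On this event the upper Q-estimate lies between the backup and the backup plus two bonuses, and the
lower one mirrors this. By backward induction `upV` dominates what any `π` earns against `νHat`,
while `πAux` earns at least `upV` minus twice the expected bonuses against any `ν`; `loV` is
symmetric. Testing `πAux` against `νStar` and `νAux` against `πStar`, the values cancel by the Nash
property and only bonuses remain (`SPMVIRun.IsGood.gap_le`).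

For the rate, let `n = K / H` be the fold size. A Chernoff bound in each direction of a grid gives
`Λ_h ≥ (n κ / 32) I` once `n κ ≥ 256 d ι` (`MarkovGame.measure_gram_lt_le`), so every bonus is at
most `β / √(n κ / 32)`. For smaller `n κ` the claimed bound exceeds `H` and is trivial. -/

noncomputable section

/-! ### Elementary properties of the payoff of a matrix game. -/

section Payoff

variable {A B : Type*}

theorem payoff_mono [Fintype A] [Fintype B] {Q Q' : A → B → ℝ} {p : A → ℝ} {q : B → ℝ}
    (hp : p ∈ stdSimplex ℝ A) (hq : q ∈ stdSimplex ℝ B) (h : ∀ a b, Q a b ≤ Q' a b) :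
    payoff Q p q ≤ payoff Q' p q :=
  Finset.sum_le_sum fun a _ => Finset.sum_le_sum fun b _ =>
    mul_le_mul_of_nonneg_left (h a b) (mul_nonneg (hp.1 a) (hq.1 b))

theorem payoff_const [Fintype A] [Fintype B] {p : A → ℝ} {q : B → ℝ}
    (hp : p ∈ stdSimplex ℝ A) (hq : q ∈ stdSimplex ℝ B) (t : ℝ) :
    payoff (fun _ _ => t) p q = t := by
  simp only [payoff]
  simp_rw [← Finset.sum_mul, ← Finset.mul_sum, hq.2, mul_one, hp.2, one_mul]

theorem payoff_add [Fintype A] [Fintype B] (Q Q' : A → B → ℝ) (p : A → ℝ) (q : B → ℝ) :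
    payoff (fun a b => Q a b + Q' a b) p q = payoff Q p q + payoff Q' p q := by
  simp [payoff, mul_add, Finset.sum_add_distrib]

end Payoff

/-! ### Laws of trajectories and the Bellman recursion. -/

section Trajectories

variable {S A B : Type*} [MeasurableSpace S] [MeasurableSpace A] [MeasurableSpace B]

theorem MarkovGame.lintegral_traj_succ (G : MarkovGame S A B) (σ : Policy S (A × B)) (n h : ℕ)
    (x : S) {f : (Fin (n + 1) → Transition S A B) → ENNReal} (hf : Measurable f) :
    ∫⁻ ω, f ω ∂(G.traj σ (n + 1) h x) =
      ∫⁻ c, ∫⁻ y, ∫⁻ ω, f (consTransition (x, ((c, y), ω))) ∂(G.traj σ n (h + 1) y)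
        ∂(G.P h (x, c)) ∂(σ.kernel h x) := by
  have h1 : Measurable fun q => f (consTransition (S := S) (A := A) (B := B) (n := n) q) :=
    hf.comp measurable_consTransition
  rw [MarkovGame.traj, Kernel.lintegral_map _ measurable_consTransition _ hf,
    Kernel.lintegral_id_prod h1]
  have h2 : Measurable fun q => f (consTransition (S := S) (A := A) (B := B) (n := n) (x, q)) :=
    h1.comp measurable_prodMk_left
  rw [Kernel.lintegral_compProd _ _ _ h2, Kernel.lintegral_compProd]
  · simp only [Kernel.comap_apply]
  · exact Measurable.lintegral_kernel_prod_right' (κ := ((G.traj σ n (h + 1)).comap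
      (fun p : S × ((A × B) × S) => p.2.2) (measurable_snd.comp measurable_snd)).comap
        (Prod.mk x) measurable_prodMk_left) h2

/-- Given the state and the actions, the next state is drawn from the transition kernel. -/
theorem MarkovGame.lintegral_traj_eval (G : MarkovGame S A B) (σ : Policy S (A × B)) (n h : ℕ)
    (x : S) (j : Fin n) {f : Transition S A B → ENNReal} (hf : Measurable f) :
    ∫⁻ ω, f (ω j) ∂(G.traj σ n h x) =
      ∫⁻ ω, ∫⁻ y, f ((ω j).1, y) ∂(G.P (h + j) (ω j).1) ∂(G.traj σ n h x) := by
  induction n generalizing h x with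
  | zero => exact j.elim0
  | succ n ih =>
    have hf' : ∀ k : ℕ, Measurable fun z : S × A × B => ∫⁻ y, f (z, y) ∂(G.P k z) :=
      fun k => hf.lintegral_kernel_prod_right'
    rw [G.lintegral_traj_succ σ n h x (f := fun ω => f (ω j)) (hf.comp (measurable_pi_apply j)),
      G.lintegral_traj_succ σ n h x
        (f := fun ω => ∫⁻ y, f ((ω j).1, y) ∂(G.P (h + j) (ω j).1))
        ((hf' (h + j)).comp (measurable_fst.comp (measurable_pi_apply j)))]
    refine Fin.cases ?_ (fun i => ?_) j
    · simp [consTransition]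
    · have e : h + (i.succ : ℕ) = (h + 1) + i := by simp [Fin.val_succ]; ring
      simp only [consTransition, Fin.cons_succ, e]
      simp_rw [← ih (h + 1) _ i]

theorem MarkovGame.integral_traj_succ (G : MarkovGame S A B) (σ : Policy S (A × B)) (n h : ℕ)
    (x : S) {f : (Fin (n + 1) → Transition S A B) → ℝ} (hf : Measurable f) {M : ℝ}
    (hM : ∀ ω, |f ω| ≤ M) :
    ∫ ω, f ω ∂(G.traj σ (n + 1) h x) =
      ∫ c, ∫ y, ∫ ω, f (consTransition (x, ((c, y), ω))) ∂(G.traj σ n (h + 1) y)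
        ∂(G.P h (x, c)) ∂(σ.kernel h x) := by
  have h1 : Measurable fun q => f (consTransition (S := S) (A := A) (B := B) (n := n) q) :=
    hf.comp measurable_consTransition
  have h2 := h1.comp (measurable_prodMk_left (x := x))
  rw [MarkovGame.traj, Kernel.map_apply _ measurable_consTransition,
    integral_map measurable_consTransition.aemeasurable hf.aestronglyMeasurable,
    Kernel.prod_apply, Kernel.id_apply, Measure.dirac_prod,
    integral_map measurable_prodMk_left.aemeasurable h1.aestronglyMeasurable,
    ProbabilityTheory.integral_compProd, ProbabilityTheory.integral_compProd]
  · simp only [Kernel.comap_apply]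
  · refine Integrable.of_bound (C := M) ?_ (ae_of_all _ fun p => ?_)
    · exact (StronglyMeasurable.integral_kernel_prod_right' (κ := ((G.traj σ n (h + 1)).comap
        (fun p : S × ((A × B) × S) => p.2.2) (measurable_snd.comp measurable_snd)).comap
        (Prod.mk x) measurable_prodMk_left) h2.stronglyMeasurable).aestronglyMeasurable
    · refine (norm_integral_le_of_norm_le_const (ae_of_all _ fun ω => hM _)).trans ?_
      simp
  · exact Integrable.of_bound h2.aestronglyMeasurable M (ae_of_all _ fun p => hM _)

/-- The expected sum of `g` over the `n` steps that start at step `h` in state `x`. -/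
def MarkovGame.expSum (G : MarkovGame S A B) (σ : Policy S (A × B)) (g : ℕ → S × A × B → ℝ)
    (n h : ℕ) (x : S) : ℝ :=
  ∫ ω, ∑ j : Fin n, g (h + j) (ω j).1 ∂(G.traj σ n h x)

theorem MarkovGame.measurable_expSum (G : MarkovGame S A B) (σ : Policy S (A × B))
    {g : ℕ → S × A × B → ℝ} (hg : ∀ h, Measurable (g h)) (n h : ℕ) :
    Measurable (G.expSum σ g n h) := by
  have : Measurable fun ω : Fin n → Transition S A B => ∑ j : Fin n, g (h + j) (ω j).1 :=
    Finset.measurable_sum _ fun j _ =>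
      (hg _).comp (measurable_fst.comp (measurable_pi_apply j))
  exact (this.stronglyMeasurable.integral_kernel (κ := G.traj σ n h)).measurable

theorem MarkovGame.expSum_zero (G : MarkovGame S A B) (σ : Policy S (A × B))
    (g : ℕ → S × A × B → ℝ) (h : ℕ) (x : S) : G.expSum σ g 0 h x = 0 := by
  simp [MarkovGame.expSum]

theorem MarkovGame.abs_expSum_le (G : MarkovGame S A B) (σ : Policy S (A × B))
    {g : ℕ → S × A × B → ℝ} {M : ℝ} (hM : ∀ h z, |g h z| ≤ M) (n h : ℕ) (x : S) :
    |G.expSum σ g n h x| ≤ n * M := by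
  refine (norm_integral_le_of_norm_le_const (μ := G.traj σ n h x) (C := n * M)
    (f := fun ω => ∑ j : Fin n, g (h + j) (ω j).1) (ae_of_all _ fun ω => ?_)).trans ?_
  · refine (Finset.abs_sum_le_sum_abs _ _).trans ((Finset.sum_le_sum fun j _ => hM _ _).trans ?_)
    simp
  · simp

theorem MarkovGame.expSum_nonneg (G : MarkovGame S A B) (σ : Policy S (A × B))
    {g : ℕ → S × A × B → ℝ} (hg : ∀ h z, 0 ≤ g h z) (n h : ℕ) (x : S) :
    0 ≤ G.expSum σ g n h x :=
  integral_nonneg fun _ => Finset.sum_nonneg fun _ _ => hg _ _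

/-- The Bellman recursion: condition on the first transition. It is stated for general step
functions `g`, since it is needed both for rewards and for bonuses. -/
theorem MarkovGame.expSum_succ (G : MarkovGame S A B) (σ : Policy S (A × B))
    {g : ℕ → S × A × B → ℝ} (hg : ∀ h, Measurable (g h)) {M : ℝ} (hM : ∀ h z, |g h z| ≤ M)
    (n h : ℕ) (x : S) :
    G.expSum σ g (n + 1) h x =
      ∫ c, (g h (x, c) + ∫ y, G.expSum σ g n (h + 1) y ∂(G.P h (x, c))) ∂(σ.kernel h x) := by
  have hmeas : ∀ n h, Measurable fun ω : Fin n → Transition S A B =>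
      ∑ j : Fin n, g (h + j) (ω j).1 := fun n h =>
    Finset.measurable_sum _ fun j _ =>
      (hg _).comp (measurable_fst.comp (measurable_pi_apply j))
  have hbd : ∀ n h, ∀ ω : Fin n → Transition S A B,
      |∑ j : Fin n, g (h + j) (ω j).1| ≤ n * M := fun n h ω => by
    refine (Finset.abs_sum_le_sum_abs _ _).trans ((Finset.sum_le_sum fun j _ => hM _ _).trans ?_)
    simp
  rw [MarkovGame.expSum, G.integral_traj_succ σ n h x (hmeas _ h) (hbd _ h)]
  refine integral_congr_ae (ae_of_all _ fun c => ?_)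
  have hcons : ∀ (y : S) (ω : Fin n → Transition S A B),
      ∑ j : Fin (n + 1), g (h + j) (consTransition (x, ((c, y), ω)) j).1 =
        g h (x, c) + ∑ j : Fin n, g (h + 1 + j) (ω j).1 := by
    intro y ω
    rw [Fin.sum_univ_succ]
    have e : ∀ i : Fin n, h + (i.succ : ℕ) = (h + 1) + i := fun i => by
      simp [Fin.val_succ]; ring
    simp only [consTransition, Fin.cons_zero, Fin.cons_succ, e, Fin.val_zero, add_zero]
  have hint : ∀ y, Integrable (fun ω : Fin n → Transition S A B =>
      ∑ j : Fin n, g (h + 1 + j) (ω j).1) (G.traj σ n (h + 1) y) := fun y =>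
    Integrable.of_bound (hmeas n (h + 1)).aestronglyMeasurable (n * M)
      (ae_of_all _ (hbd n (h + 1)))
  have hint' : Integrable (G.expSum σ g n (h + 1)) (G.P h (x, c)) :=
    Integrable.of_bound (G.measurable_expSum σ hg n (h + 1)).aestronglyMeasurable (n * M)
      (ae_of_all _ (G.abs_expSum_le σ hM n (h + 1)))
  simp only [hcons]
  have : ∀ y, ∫ ω, (g h (x, c) + ∑ j : Fin n, g (h + 1 + j) (ω j).1) ∂(G.traj σ n (h + 1) y) =
      g h (x, c) + G.expSum σ g n (h + 1) y := fun y => by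
    rw [integral_add (integrable_const _) (hint y)]; simp [MarkovGame.expSum]
  simp only [this]
  rw [integral_add (integrable_const _) hint']
  simp

theorem Policy.integral_joint [Fintype A] [MeasurableSingletonClass A] [Fintype B]
    [MeasurableSingletonClass B] (π : Policy S A) (ν : Policy S B) (h : ℕ) (x : S)
    (F : A × B → ℝ) :
    ∫ c, F c ∂((π.joint ν).kernel h x) =
      payoff (fun a b => F (a, b)) (π.prob h x) (ν.prob h x) := by
  rw [integral_fintype .of_finite, Fintype.sum_prod_type]
  simp only [payoff, Policy.joint, Policy.prob, Kernel.prod_apply, smul_eq_mul]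
  refine Finset.sum_congr rfl fun a _ => Finset.sum_congr rfl fun b _ => ?_
  rw [← Set.singleton_prod_singleton, measureReal_prod_prod]

theorem Policy.prob_mem_stdSimplex [Fintype A] [MeasurableSingletonClass A] (π : Policy S A)
    (h : ℕ) (x : S) : π.prob h x ∈ stdSimplex ℝ A := by
  refine ⟨fun a => measureReal_nonneg, ?_⟩
  simp only [Policy.prob]
  rw [sum_measureReal_singleton]
  simp

/-- This disintegration is what makes the regression noise centred, given the observed states and
actions of the step. -/
theorem MarkovGame.trajLaw_map_eval (G : MarkovGame S A B) (ρ : Measure S)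
    [IsProbabilityMeasure ρ] (b : Policy S (A × B)) {H : ℕ} (h : Fin H) :
    (G.trajLaw ρ b H).map (fun ω => ω h) =
      ((G.trajLaw ρ b H).map fun ω => (ω h).1) ⊗ₘ G.P h := by
  have hm1 : Measurable fun ω : Fin H → Transition S A B => (ω h).1 := by fun_prop
  have hm0 : Measurable fun ω : Fin H → Transition S A B => ω h := by fun_prop
  have : IsProbabilityMeasure (G.trajLaw ρ b H) := by
    unfold MarkovGame.trajLaw; infer_instance
  have : IsProbabilityMeasure ((G.trajLaw ρ b H).map fun ω => (ω h).1) :=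
    Measure.isProbabilityMeasure_map hm1.aemeasurable
  refine Measure.ext_of_lintegral _ fun f hf => ?_
  rw [lintegral_map hf hm0, Measure.lintegral_compProd hf,
    lintegral_map (hf.lintegral_kernel_prod_right') hm1, MarkovGame.trajLaw,
    Measure.lintegral_bind (m := ρ) (μ := G.traj b H 0) (f := fun ω => f (ω h)) (Kernel.aemeasurable _)
      (hf.comp hm0).aemeasurable,
    Measure.lintegral_bind (m := ρ) (μ := G.traj b H 0)
      (f := fun ω => ∫⁻ y, f ((ω h).1, y) ∂(G.P h (ω h).1))
      (Kernel.aemeasurable _) ((hf.lintegral_kernel_prod_right').comp hm1).aemeasurable]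
  refine lintegral_congr fun x => ?_
  have := G.lintegral_traj_eval b H 0 x h hf
  simpa using this

end Trajectories

/-! ### Conditioning in product measures. -/

section ProductMeasures

variable {ι X Z S : Type*} [Fintype ι] [MeasurableSpace X] [MeasurableSpace Z] [MeasurableSpace S]

theorem lintegral_pi_prod (μ : ι → Measure X) [∀ i, IsProbabilityMeasure (μ i)]
    {f : ι → X → ENNReal} (hf : ∀ i, Measurable (f i)) (s : Finset ι) :
    ∫⁻ ω, ∏ i ∈ s, f i (ω i) ∂(Measure.pi μ) = ∏ i ∈ s, ∫⁻ x, f i x ∂(μ i) := by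
  rw [lintegral_prod_eq_prod_lintegral_of_indepFun s (fun i (ω : ι → X) => f i (ω i))
    (iIndepFun_pi fun i => (hf i).aemeasurable) fun i => (hf i).comp (measurable_pi_apply i)]
  exact Finset.prod_congr rfl fun i _ =>
    (measurePreserving_eval μ i).lintegral_comp (hf i)

/-- The product, over `τ`, of the measures `P (z τ)`, as a kernel in `z`. -/
def piKernel (ι : Type*) [Fintype ι] (P : Kernel Z S) [IsMarkovKernel P] :
    Kernel (ι → Z) (ι → S) where
  toFun z := Measure.pi fun τ => P (z τ)
  measurable' := by
    refine Measurable.measure_of_isPiSystem_of_isProbabilityMeasure generateFrom_pi.symm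
      isPiSystem_pi ?_
    rintro _ ⟨t, ht, rfl⟩
    simp only [Measure.pi_pi]
    exact Finset.measurable_prod _ fun i _ =>
      (P.measurable_coe (ht i trivial)).comp (measurable_pi_apply i)

theorem piKernel_apply (P : Kernel Z S) [IsMarkovKernel P] (z : ι → Z) :
    piKernel ι P z = Measure.pi fun τ => P (z τ) := rfl

instance (P : Kernel Z S) [IsMarkovKernel P] : IsMarkovKernel (piKernel ι P) :=
  ⟨fun z => by rw [piKernel_apply]; infer_instance⟩

/-- Independent pairs may be sampled by drawing all first components, then all second ones; it
suffices to compare the two laws on boxes. -/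
theorem measure_pi_compProd (m : Measure Z) [IsProbabilityMeasure m] (P : Kernel Z S)
    [IsMarkovKernel P] :
    Measure.pi (fun _ : ι => m ⊗ₘ P) =
      ((Measure.pi fun _ : ι => m) ⊗ₘ piKernel ι P).map fun q τ => (q.1 τ, q.2 τ) := by
  have hm : Measurable fun (q : (ι → Z) × (ι → S)) (τ : ι) => (q.1 τ, q.2 τ) := by fun_prop
  refine Measure.pi_eq fun s hs => ?_
  rw [Measure.map_apply hm (MeasurableSet.univ_pi hs),
    Measure.compProd_apply (hm (MeasurableSet.univ_pi hs))]
  have h1 : ∀ z : ι → Z, (piKernel ι P) z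
      (Prod.mk z ⁻¹' ((fun (q : (ι → Z) × (ι → S)) (τ : ι) => (q.1 τ, q.2 τ)) ⁻¹' Set.univ.pi s)) =
      ∏ i, P (z i) (Prod.mk (z i) ⁻¹' s i) := by
    intro z
    rw [piKernel_apply, ← Measure.pi_pi]
    congr 1
  simp only [h1]
  rw [lintegral_pi_prod (fun _ : ι => m) (f := fun i z => P z (Prod.mk z ⁻¹' s i))
    (fun i => Kernel.measurable_kernel_prodMk_left (hs i))]
  exact Finset.prod_congr rfl fun i _ => (Measure.compProd_apply (hs i)).symm

/-- To bound a probability for independent pairs, it is enough to bound it conditionally on the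
first components. -/
theorem measure_pi_compProd_le (m : Measure Z) [IsProbabilityMeasure m] (P : Kernel Z S)
    [IsMarkovKernel P] {E : Set (ι → Z × S)} (hE : MeasurableSet E) {ε : ENNReal}
    (h : ∀ z : ι → Z, Measure.pi (fun τ => P (z τ)) {x | (fun τ => (z τ, x τ)) ∈ E} ≤ ε) :
    Measure.pi (fun _ : ι => m ⊗ₘ P) E ≤ ε := by
  have hm : Measurable fun (q : (ι → Z) × (ι → S)) (τ : ι) => (q.1 τ, q.2 τ) := by fun_prop
  rw [measure_pi_compProd, Measure.map_apply hm hE, Measure.compProd_apply (hm hE)]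
  calc _ ≤ ∫⁻ _, ε ∂(Measure.pi fun _ : ι => m) := lintegral_mono fun z => h z
    _ = ε := by simp

/-- To bound a probability for independent variables, it is enough to bound it conditionally on
some of them. -/
theorem measure_pi_le_of_forall_ite (μ : Measure X) [IsProbabilityMeasure μ] (p : ι → Prop)
    [DecidablePred p] {E : Set (ι → X)} (hE : MeasurableSet E) {ε : ENNReal}
    (h : ∀ y : ι → X,
      Measure.pi (fun _ : ι => μ) {ω | (fun τ => if p τ then ω τ else y τ) ∈ E} ≤ ε) :
    Measure.pi (fun _ : ι => μ) E ≤ ε := by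
  have hm : Measurable fun (q : (ι → X) × (ι → X)) (τ : ι) => if p τ then q.2 τ else q.1 τ := by
    refine measurable_pi_iff.mpr fun τ => ?_
    by_cases hp : p τ <;> simp only [hp, if_true, if_false] <;> fun_prop
  -- Splicing two independent copies along `p` does not change the law; fixing the first copy then
  -- amounts to conditioning on the coordinates outside `p`.
  have key : Measure.pi (fun _ : ι => μ) =
      ((Measure.pi fun _ : ι => μ).prod (Measure.pi fun _ : ι => μ)).map
        fun q τ => if p τ then q.2 τ else q.1 τ := by
    refine Measure.pi_eq fun s hs => ?_
    rw [Measure.map_apply hm (MeasurableSet.univ_pi hs)]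
    have : (fun (q : (ι → X) × (ι → X)) (τ : ι) => if p τ then q.2 τ else q.1 τ) ⁻¹'
        Set.univ.pi s = (Set.univ.pi fun τ => if p τ then Set.univ else s τ) ×ˢ
          (Set.univ.pi fun τ => if p τ then s τ else Set.univ) := by
      ext q
      simp only [Set.mem_preimage, Set.mem_pi, Set.mem_prod, Set.mem_univ, true_imp_iff]
      rw [← forall_and]
      refine forall_congr' fun τ => ?_
      by_cases hp : p τ <;> simp [hp]
    rw [this, Measure.prod_prod, Measure.pi_pi, Measure.pi_pi, ← Finset.prod_mul_distrib]
    refine Finset.prod_congr rfl fun τ _ => ?_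
    by_cases hp : p τ <;> simp [hp]
  rw [key, Measure.map_apply hm hE, Measure.prod_apply (hm hE)]
  calc _ ≤ ∫⁻ _, ε ∂(Measure.pi fun _ : ι => μ) := lintegral_mono fun y => h y
    _ = ε := by simp

end ProductMeasures

/-! ### Regularized Gram matrices and the norms of their inverses. -/

section MatNorm

open Matrix
open scoped MatrixOrder Matrix.Norms.L2Operator

variable {d : ℕ} {ι : Type*}

theorem norm_toLp_sq (v : Fin d → ℝ) : ‖WithLp.toLp 2 v‖ ^ 2 = v ⬝ᵥ v := by
  rw [EuclideanSpace.real_norm_sq_eq]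
  simp [dotProduct, sq]

/-- The regularized Gram matrix of the vectors `f τ`, `τ ∈ s`. -/
def regGram (s : Finset ι) (f : ι → EuclideanSpace ℝ (Fin d)) : Matrix (Fin d) (Fin d) ℝ :=
  ∑ τ ∈ s, vecMulVec (f τ).ofLp (f τ).ofLp + 1

theorem regGram_mulVec (s : Finset ι) (f : ι → EuclideanSpace ℝ (Fin d)) (v : Fin d → ℝ) :
    regGram s f *ᵥ v = ∑ τ ∈ s, ((f τ).ofLp ⬝ᵥ v) • (f τ).ofLp + v := by
  simp [regGram, add_mulVec, sum_mulVec, vecMulVec_mulVec]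

theorem dotProduct_regGram (s : Finset ι) (f : ι → EuclideanSpace ℝ (Fin d)) (v : Fin d → ℝ) :
    v ⬝ᵥ regGram s f *ᵥ v = ∑ τ ∈ s, ((f τ).ofLp ⬝ᵥ v) ^ 2 + v ⬝ᵥ v := by
  rw [regGram_mulVec, dotProduct_add, dotProduct_sum]
  congr 1
  refine Finset.sum_congr rfl fun τ _ => ?_
  rw [dotProduct_smul, dotProduct_comm v, smul_eq_mul, sq]

theorem dotProduct_self_le_regGram (s : Finset ι) (f : ι → EuclideanSpace ℝ (Fin d))
    (v : Fin d → ℝ) : v ⬝ᵥ v ≤ v ⬝ᵥ regGram s f *ᵥ v := by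
  rw [dotProduct_regGram]
  have : 0 ≤ ∑ τ ∈ s, ((f τ).ofLp ⬝ᵥ v) ^ 2 := Finset.sum_nonneg fun _ _ => sq_nonneg _
  linarith

theorem posDef_regGram (s : Finset ι) (f : ι → EuclideanSpace ℝ (Fin d)) :
    (regGram s f).PosDef := by
  refine PosDef.posSemidef_add (posSemidef_sum s fun τ _ => ?_) PosDef.one
  simpa using posSemidef_vecMulVec_self_star (R := ℝ) (f τ).ofLp

/-- A whitening matrix. It turns `matNorm L⁻¹` into a Euclidean norm, which yields the triangle and
Cauchy–Schwarz inequalities below; the second identity bounds the rows of whitened features. -/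
theorem Matrix.PosDef.exists_inv_factor {L : Matrix (Fin d) (Fin d) ℝ} (hL : L.PosDef) :
    ∃ M : Matrix (Fin d) (Fin d) ℝ, L⁻¹ = Mᵀ * M ∧ M * L * Mᵀ = 1 := by
  obtain ⟨M, hM⟩ : ∃ M : Matrix (Fin d) (Fin d) ℝ, L⁻¹ = Mᵀ * M := by
    obtain ⟨M, hM⟩ := CStarAlgebra.nonneg_iff_eq_star_mul_self.mp hL.inv.posSemidef.nonneg
    exact ⟨M, by rw [hM, star_eq_conjTranspose, conjTranspose_eq_transpose_of_trivial]⟩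
  refine ⟨M, hM, ?_⟩
  have hdet : IsUnit L.det := (Matrix.isUnit_iff_isUnit_det L).mp hL.isUnit
  have h1 : Mᵀ * (M * L) = 1 := by rw [← mul_assoc, ← hM, nonsing_inv_mul _ hdet]
  exact mul_eq_one_comm.mp h1

theorem matNorm_factor (M : Matrix (Fin d) (Fin d) ℝ) (u : EuclideanSpace ℝ (Fin d)) :
    matNorm (Mᵀ * M) u = ‖WithLp.toLp 2 (M *ᵥ u.ofLp)‖ := by
  rw [matNorm, ← mulVec_mulVec, dotProduct_mulVec, vecMul_transpose, ← norm_toLp_sq,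
    Real.sqrt_sq (norm_nonneg _)]

theorem matNorm_nonneg (M : Matrix (Fin d) (Fin d) ℝ) (u : EuclideanSpace ℝ (Fin d)) :
    0 ≤ matNorm M u := Real.sqrt_nonneg _

theorem matNorm_inv_sub_le {L : Matrix (Fin d) (Fin d) ℝ} (hL : L.PosDef)
    (u v : EuclideanSpace ℝ (Fin d)) :
    matNorm L⁻¹ (u - v) ≤ matNorm L⁻¹ u + matNorm L⁻¹ v := by
  obtain ⟨M, hM, -⟩ := hL.exists_inv_factor
  simp only [hM, matNorm_factor, WithLp.ofLp_sub, mulVec_sub, WithLp.toLp_sub]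
  exact norm_sub_le _ _

theorem abs_dotProduct_inv_mulVec_le {L : Matrix (Fin d) (Fin d) ℝ} (hL : L.PosDef)
    (u v : EuclideanSpace ℝ (Fin d)) :
    |u.ofLp ⬝ᵥ L⁻¹ *ᵥ v.ofLp| ≤ matNorm L⁻¹ u * matNorm L⁻¹ v := by
  obtain ⟨M, hM, -⟩ := hL.exists_inv_factor
  rw [hM, matNorm_factor, matNorm_factor, ← mulVec_mulVec, dotProduct_mulVec, vecMul_transpose]
  have := abs_real_inner_le_norm (WithLp.toLp 2 (M *ᵥ u.ofLp)) (WithLp.toLp 2 (M *ᵥ v.ofLp))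
  rwa [EuclideanSpace.inner_toLp_toLp, dotProduct_comm, star_trivial] at this

/-- With `w = L⁻¹ u` and `q = w · u`, the hypothesis reads `α ‖w‖² ≤ q` and Cauchy–Schwarz `q ≤ ‖u‖
‖w‖`. Hence `α q² ≤ ‖u‖² q`, and a factor `q` cancels unless it vanishes. -/
theorem matNorm_inv_le {L : Matrix (Fin d) (Fin d) ℝ} (hL : L.PosDef) {α : ℝ} (hα : 0 < α)
    (h : ∀ v, α * (v ⬝ᵥ v) ≤ v ⬝ᵥ L *ᵥ v) (u : EuclideanSpace ℝ (Fin d)) :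
    matNorm L⁻¹ u ≤ ‖u‖ / √α := by
  have hdet : IsUnit L.det := (Matrix.isUnit_iff_isUnit_det L).mp hL.isUnit
  set w := L⁻¹ *ᵥ u.ofLp with hw
  have hLw : L *ᵥ w = u.ofLp := by rw [hw, mulVec_mulVec, mul_nonsing_inv _ hdet, one_mulVec]
  have h1 := h w
  rw [hLw] at h1
  have h2 := abs_real_inner_le_norm u (WithLp.toLp 2 w)
  have h3 : inner ℝ u (WithLp.toLp 2 w) = w ⬝ᵥ u.ofLp := by
    rw [← WithLp.toLp_ofLp 2 u, EuclideanSpace.inner_toLp_toLp, star_trivial]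
  rw [h3] at h2
  rw [← norm_toLp_sq] at h1
  have hq : 0 ≤ w ⬝ᵥ u.ofLp := le_trans (by positivity) h1
  rw [abs_of_nonneg hq] at h2
  rw [matNorm, ← hw, dotProduct_comm]
  refine Real.sqrt_le_iff.mpr ⟨by positivity, ?_⟩
  rw [div_pow, Real.sq_sqrt hα.le, le_div_iff₀ hα]
  rcases hq.eq_or_lt with h0 | h0
  · rw [← h0, zero_mul]; positivity
  · have h4 : (w ⬝ᵥ u.ofLp) ^ 2 * α ≤ ‖u‖ ^ 2 * (w ⬝ᵥ u.ofLp) := by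
      calc (w ⬝ᵥ u.ofLp) ^ 2 * α ≤ (‖u‖ * ‖WithLp.toLp 2 w‖) ^ 2 * α := by gcongr
        _ = ‖u‖ ^ 2 * (α * ‖WithLp.toLp 2 w‖ ^ 2) := by ring
        _ ≤ _ := by gcongr
    nlinarith

theorem matNorm_regGram_inv_le (s : Finset ι) (f : ι → EuclideanSpace ℝ (Fin d))
    (u : EuclideanSpace ℝ (Fin d)) : matNorm (regGram s f)⁻¹ u ≤ ‖u‖ := by
  have := matNorm_inv_le (posDef_regGram s f) one_pos
    (fun v => by simpa using dotProduct_self_le_regGram s f v) u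
  simpa using this

end MatNorm

/-! ### Concentration of self-normalized noise for fixed features. -/

section Noise

open Matrix

variable {d : ℕ} {ι S : Type*} [Fintype ι] [MeasurableSpace S]

theorem ProbabilityTheory.HasSubgaussianMGF.mono {Ω : Type*} [MeasurableSpace Ω] {μ : Measure Ω}
    {X : Ω → ℝ} {c c' : NNReal} (h : HasSubgaussianMGF X c μ) (hc : c ≤ c') :
    HasSubgaussianMGF X c' μ :=
  ⟨h.integrable_exp_mul, fun t => (h.mgf_le t).trans (by gcongr)⟩

/-- A two-sided Hoeffding inequality for weighted sums of bounded independent variables. -/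
theorem measure_abs_weighted_sum_ge_le (κ : ι → Measure S) [∀ τ, IsProbabilityMeasure (κ τ)]
    {V : S → ℝ} (hVm : Measurable V) {M : ℝ} (hV : ∀ x, V x ∈ Set.Icc 0 M) (s : Finset ι)
    {a : ι → ℝ} (ha : ∑ τ ∈ s, a τ ^ 2 ≤ 1) {t : ℝ} (ht : 0 ≤ t) :
    Measure.pi κ {x | t ≤ |∑ τ ∈ s, a τ * (V (x τ) - ∫ y, V y ∂(κ τ))|} ≤
      ENNReal.ofReal (2 * Real.exp (-(2 * t ^ 2 / M ^ 2))) := by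
  set X : (ι → S) → ℝ := fun x => ∑ τ ∈ s, a τ * (V (x τ) - ∫ y, V y ∂(κ τ)) with hX
  have h1 : ∀ τ, HasSubgaussianMGF (fun x => V x - ∫ y, V y ∂(κ τ)) ((‖M - 0‖₊ / 2) ^ 2) (κ τ) :=
    fun τ => hasSubgaussianMGF_of_mem_Icc hVm.aemeasurable (ae_of_all _ hV)
  have h2 : ∀ τ, HasSubgaussianMGF (fun x : ι → S => a τ * (V (x τ) - ∫ y, V y ∂(κ τ)))
      ((a τ ^ 2).toNNReal * (‖M - 0‖₊ / 2) ^ 2) (Measure.pi κ) := fun τ => by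
    have e : (a τ ^ 2).toNNReal = ⟨a τ ^ 2, sq_nonneg _⟩ := Real.toNNReal_of_nonneg _
    rw [e]
    refine HasSubgaussianMGF.const_mul ?_ (a τ)
    refine HasSubgaussianMGF.of_map (Y := fun x : ι → S => x τ)
      (X := fun x => V x - ∫ y, V y ∂(κ τ)) (measurable_pi_apply τ).aemeasurable ?_
    rw [(measurePreserving_eval κ τ).map_eq]
    exact h1 τ
  have hind : iIndepFun (fun τ (x : ι → S) => a τ * (V (x τ) - ∫ y, V y ∂(κ τ)))
      (Measure.pi κ) :=
    iIndepFun_pi (X := fun τ x => a τ * (V x - ∫ y, V y ∂(κ τ))) fun τ =>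
      (measurable_const.mul (hVm.sub measurable_const)).aemeasurable
  -- The variance proxies add up to `(∑ a τ ^ 2) (M / 2) ^ 2`, so the sum is no worse than a single
  -- variable.
  have h3 : HasSubgaussianMGF X ((‖M - 0‖₊ / 2) ^ 2) (Measure.pi κ) := by
    refine (HasSubgaussianMGF.sum_of_iIndepFun hind fun τ _ => h2 τ).mono ?_
    rw [← Finset.sum_mul]
    refine mul_le_of_le_one_left (by positivity) ?_
    rw [← NNReal.coe_le_coe]
    simpa [Real.coe_toNNReal _ (sq_nonneg _)] using ha
  have hc : -t ^ 2 / (2 * (((‖M - 0‖₊ / 2) ^ 2 : NNReal) : ℝ)) = -(2 * t ^ 2 / M ^ 2) := by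
    simp only [NNReal.coe_pow, NNReal.coe_div, coe_nnnorm, sub_zero, Real.norm_eq_abs, div_pow,
      sq_abs, NNReal.coe_ofNat]
    by_cases hM : M = 0
    · simp [hM]
    · field_simp
  have h4 := h3.measure_ge_le ht
  have h5 := h3.neg.measure_ge_le ht
  rw [hc] at h4 h5
  have hsub : {x | t ≤ |X x|} ⊆ {x | t ≤ X x} ∪ {x | t ≤ (-X) x} := fun x hx => by
    rcases le_abs.mp (show t ≤ |X x| from hx) with h | h
    · exact Or.inl h
    · exact Or.inr h
  refine (measure_mono hsub).trans ((measure_union_le _ _).trans ?_)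
  rw [two_mul, ENNReal.ofReal_add (Real.exp_pos _).le (Real.exp_pos _).le]
  refine add_le_add ?_ ?_
  · rw [← ofReal_measureReal]; exact ENNReal.ofReal_le_ofReal h4
  · rw [← ofReal_measureReal]; exact ENNReal.ofReal_le_ofReal h5

/-- For the whitening matrix `N`, the diagonal of `N Λ Nᵀ = 1` says that the squares of the `i`-th
coordinates of the `N f_τ`, plus `‖N_i‖²`, add up to `1`. Each coordinate of the whitened noise thus
obeys Hoeffding with unit weights; if all `d` coordinates are below `t`, the norm is at most `√d t`.
-/
theorem measure_matNorm_noise_le (κ : ι → Measure S) [∀ τ, IsProbabilityMeasure (κ τ)]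
    {V : S → ℝ} (hVm : Measurable V) {M : ℝ} (hV : ∀ x, V x ∈ Set.Icc 0 M) (s : Finset ι)
    (f : ι → EuclideanSpace ℝ (Fin d)) {t : ℝ} (ht : 0 ≤ t) :
    Measure.pi κ {x : ι → S | √d * t <
        matNorm (regGram s f)⁻¹ (∑ τ ∈ s, (V (x τ) - ∫ y, V y ∂(κ τ)) • f τ)} ≤
      ENNReal.ofReal (d * (2 * Real.exp (-(2 * t ^ 2 / M ^ 2)))) := by
  obtain ⟨N, hN, hN1⟩ := (posDef_regGram s f).exists_inv_factor
  have ha : ∀ i, ∑ τ ∈ s, (N *ᵥ (f τ).ofLp) i ^ 2 ≤ 1 := fun i => by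
    have h1 : N i ⬝ᵥ regGram s f *ᵥ N i = 1 := by
      have := congrFun (congrFun hN1 i) i
      rw [mul_assoc, one_apply_eq, mul_apply_eq_vecMul] at this
      rw [← this]
      simp [vecMul, dotProduct, mul_apply, mulVec, Finset.mul_sum]
    rw [dotProduct_regGram] at h1
    have h2 : 0 ≤ N i ⬝ᵥ N i := by rw [← norm_toLp_sq]; positivity
    have h3 : ∀ τ, (N *ᵥ (f τ).ofLp) i = (f τ).ofLp ⬝ᵥ N i := fun τ => by
      rw [dotProduct_comm]; rfl
    simp only [h3]
    linarith
  have hsub : {x : ι → S | √d * t <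
        matNorm (regGram s f)⁻¹ (∑ τ ∈ s, (V (x τ) - ∫ y, V y ∂(κ τ)) • f τ)} ⊆
      ⋃ i ∈ (Finset.univ : Finset (Fin d)), {x : ι → S | t ≤ |∑ τ ∈ s, (N *ᵥ (f τ).ofLp) i *
        (V (x τ) - ∫ y, V y ∂(κ τ))|} := by
    intro x hx
    by_contra hcon
    simp only [Finset.mem_univ, Set.iUnion_true, Set.mem_iUnion, Set.mem_ofPred_eq, not_exists,
      not_le] at hcon
    rw [Set.mem_ofPred_eq] at hx
    refine absurd hx (not_lt.mpr ?_)
    rw [hN, matNorm_factor]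
    refine abs_le_of_sq_le_sq' ?_ (by positivity) |>.2
    rw [mul_pow, Real.sq_sqrt (Nat.cast_nonneg _), EuclideanSpace.real_norm_sq_eq]
    calc _ ≤ ∑ i : Fin d, t ^ 2 := Finset.sum_le_sum fun i _ => ?_
      _ = d * t ^ 2 := by simp
    refine sq_le_sq' ?_ ?_ <;> [skip; skip]
    all_goals
      have := (abs_lt.mp (hcon i))
      simp only [WithLp.ofLp_sum, WithLp.ofLp_smul, mulVec_sum, mulVec_smul, Finset.sum_apply,
        Pi.smul_apply, smul_eq_mul]
      simp_rw [mul_comm (V _ - _)]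
    · exact this.1.le
    · exact this.2.le
  refine (measure_mono hsub).trans ((measure_biUnion_finset_le _ _).trans ?_)
  refine (Finset.sum_le_sum fun i _ => measure_abs_weighted_sum_ge_le κ hVm hV s (ha i) ht).trans ?_
  rw [Finset.sum_const, Finset.card_univ, Fintype.card_fin, nsmul_eq_mul,
    ENNReal.ofReal_mul (Nat.cast_nonneg _), ENNReal.ofReal_natCast]

end Noise

/-! ### Deterministic error of ridge regression. -/

section Ridge

open Matrix

variable {d : ℕ} {ι : Type*}

/-- The error of ridge regression, in terms of the noise. -/
theorem abs_ridge_error_le (s : Finset ι) (f : ι → EuclideanSpace ℝ (Fin d)) (y e : ι → ℝ)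
    (w u : EuclideanSpace ℝ (Fin d)) (hy : ∀ τ ∈ s, y τ = (f τ).ofLp ⬝ᵥ w.ofLp + e τ) :
    |u.ofLp ⬝ᵥ ((regGram s f)⁻¹ *ᵥ ∑ τ ∈ s, y τ • (f τ).ofLp) - u.ofLp ⬝ᵥ w.ofLp| ≤
      matNorm (regGram s f)⁻¹ u *
        (matNorm (regGram s f)⁻¹ (∑ τ ∈ s, e τ • f τ) + ‖w‖) := by
  have hL := posDef_regGram s f
  have hdet : IsUnit (regGram s f).det := (Matrix.isUnit_iff_isUnit_det _).mp hL.isUnit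
  -- The term `-w` is the bias of the regularization: `Λ w` exceeds the Gram sum applied to `w` by
  -- `w`.
  have h1 : ∑ τ ∈ s, y τ • (f τ).ofLp =
      regGram s f *ᵥ w.ofLp + (∑ τ ∈ s, e τ • f τ - w).ofLp := by
    rw [regGram_mulVec, Finset.sum_congr rfl fun τ hτ => by rw [hy τ hτ, add_smul],
      Finset.sum_add_distrib]
    simp only [WithLp.ofLp_sub, WithLp.ofLp_sum, WithLp.ofLp_smul]
    abel
  rw [h1, mulVec_add, mulVec_mulVec, nonsing_inv_mul _ hdet, one_mulVec, dotProduct_add,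
    add_sub_cancel_left]
  refine (abs_dotProduct_inv_mulVec_le hL _ _).trans ?_
  refine mul_le_mul_of_nonneg_left ?_ (matNorm_nonneg _ _)
  refine (matNorm_inv_sub_le hL _ _).trans ?_
  gcongr
  exact matNorm_regGram_inv_le s f w

end Ridge

/-! ### Expectations under linear transition kernels. -/

section LinearTransition

variable {d : ℕ} {S Z : Type*} [MeasurableSpace S] [MeasurableSpace Z]

/-- A discrete layer-cake formula: it reduces expectations of bounded functions to probabilities of
superlevel sets, the only quantities that the vector measure controls. -/
theorem natFloor_eq_sum_indicator (M k : ℕ) (v : ℝ) (hv : 0 ≤ v) (hvM : v ≤ M) :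
    ((⌊(k + 1 : ℝ) * v⌋₊ : ℕ) : ℝ) =
      ∑ j ∈ Finset.Icc 1 (M * (k + 1)), if (j : ℝ) ≤ (k + 1) * v then (1 : ℝ) else 0 := by
  rw [Finset.sum_ite, Finset.sum_const_zero, add_zero, Finset.sum_const, nsmul_eq_mul, mul_one]
  have : (Finset.Icc 1 (M * (k + 1))).filter (fun j : ℕ => (j : ℝ) ≤ (k + 1) * v) =
      Finset.Icc 1 ⌊(k + 1 : ℝ) * v⌋₊ := by
    ext j
    have hpos : 0 ≤ (k + 1 : ℝ) * v := by positivity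
    simp only [Finset.mem_filter, Finset.mem_Icc, Nat.le_floor_iff hpos]
    constructor
    · rintro ⟨⟨h1, -⟩, h2⟩; exact ⟨h1, h2⟩
    · rintro ⟨h1, h2⟩
      refine ⟨⟨h1, ?_⟩, h2⟩
      have : (j : ℝ) ≤ (M * (k + 1) : ℕ) := by
        push_cast
        nlinarith [show (0 : ℝ) ≤ k + 1 by positivity]
      exact_mod_cast this
  rw [this, Nat.card_Icc, Nat.add_sub_cancel]

/-- If the transition probabilities are linear in the features, so are the conditional
expectations of bounded functions of the next state. -/
theorem exists_weight_of_linear (P : Kernel Z S) [IsMarkovKernel P]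
    (φ : Z → EuclideanSpace ℝ (Fin d)) (μ : VectorMeasure S (EuclideanSpace ℝ (Fin d)))
    (hμ : ∀ z E, MeasurableSet E → (P z).real E = inner ℝ (φ z) (μ E)) {r : ℝ}
    (hr : ∀ E, MeasurableSet E → ‖μ E‖ ≤ r) {V : S → ℝ} (hVm : Measurable V) {M : ℕ}
    (hV : ∀ x, V x ∈ Set.Icc (0 : ℝ) M) :
    ∃ w : EuclideanSpace ℝ (Fin d), ‖w‖ ≤ r * M ∧
      ∀ z, ∫ x, V x ∂(P z) = inner ℝ (φ z) w := by
  have hE : ∀ k j : ℕ, MeasurableSet {x | (j : ℝ) ≤ (k + 1) * V x} := fun k j =>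
    measurableSet_le measurable_const (measurable_const.mul hVm)
  -- The integral against `μ` of `V` rounded down to multiples of `1 / (k + 1)`. It averages `M (k +
  -- 1)` vectors of norm at most `r` with weight `1 / (k + 1)`, so no total variation of `μ` is
  -- needed.
  set w : ℕ → EuclideanSpace ℝ (Fin d) := fun k =>
    (1 / (k + 1 : ℝ)) • ∑ j ∈ Finset.Icc 1 (M * (k + 1)), μ {x | (j : ℝ) ≤ (k + 1) * V x} with hw
  have hwr : ∀ k, ‖w k‖ ≤ r * M := fun k => by
    rw [hw, norm_smul, Real.norm_of_nonneg (by positivity)]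
    calc _ ≤ 1 / (k + 1 : ℝ) * ∑ j ∈ Finset.Icc 1 (M * (k + 1)), r := by
          gcongr
          exact (norm_sum_le _ _).trans (Finset.sum_le_sum fun j _ => hr _ (hE k j))
      _ = r * M := by
          rw [Finset.sum_const, Nat.card_Icc, nsmul_eq_mul]
          push_cast [Nat.add_sub_cancel]
          field_simp
  have hwz : ∀ k z, |∫ x, V x ∂(P z) - inner ℝ (φ z) (w k)| ≤ 1 / (k + 1 : ℝ) := fun k z => by
    have h1 : inner ℝ (φ z) (w k) = ∫ x, (1 / (k + 1 : ℝ)) * (⌊(k + 1 : ℝ) * V x⌋₊ : ℝ) ∂(P z) := by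
      rw [hw, inner_smul_right, inner_sum, integral_const_mul]
      congr 1
      simp_rw [fun x => natFloor_eq_sum_indicator M k (V x) (hV x).1 (hV x).2]
      rw [integral_finsetSum _ fun j _ => ?_]
      · refine Finset.sum_congr rfl fun j _ => ?_
        rw [← hμ z _ (hE k j), ← integral_indicator_one (hE k j)]
        rfl
      · exact (integrable_const (1 : ℝ)).indicator (hE k j)
    have hint : Integrable V (P z) := Integrable.of_mem_Icc 0 M hVm.aemeasurable (ae_of_all _ hV)
    have hb : ∀ x, |V x - (1 / (k + 1 : ℝ)) * (⌊(k + 1 : ℝ) * V x⌋₊ : ℝ)| ≤ 1 / (k + 1 : ℝ) := by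
      intro x
      have hk : (0 : ℝ) < k + 1 := by positivity
      have h2 := Nat.floor_le (mul_nonneg hk.le (hV x).1)
      have h3 := Nat.lt_floor_add_one ((k + 1 : ℝ) * V x)
      rw [show V x - (1 / (k + 1 : ℝ)) * (⌊(k + 1 : ℝ) * V x⌋₊ : ℝ) =
        (1 / (k + 1 : ℝ)) * ((k + 1 : ℝ) * V x - ⌊(k + 1 : ℝ) * V x⌋₊) by field_simp, abs_mul,
        abs_of_nonneg (by positivity : (0 : ℝ) ≤ 1 / (k + 1))]
      refine mul_le_of_le_one_right (by positivity) ?_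
      rw [abs_le]; constructor <;> linarith
    have hm2 : Measurable fun x => (1 / (k + 1 : ℝ)) * (⌊(k + 1 : ℝ) * V x⌋₊ : ℝ) := by
      have : Measurable fun x => ⌊(k + 1 : ℝ) * V x⌋₊ :=
        Nat.measurable_floor.comp (measurable_const.mul hVm)
      exact measurable_const.mul (measurable_from_nat.comp this)
    have hint2 : Integrable (fun x => (1 / (k + 1 : ℝ)) * (⌊(k + 1 : ℝ) * V x⌋₊ : ℝ)) (P z) := by
      have : Integrable (fun x => V x - (V x - (1 / (k + 1 : ℝ)) * (⌊(k + 1 : ℝ) * V x⌋₊ : ℝ)))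
          (P z) := hint.sub (Integrable.of_bound (hVm.sub hm2).aestronglyMeasurable _
            (ae_of_all _ hb))
      simpa using this
    rw [h1, ← integral_sub hint hint2]
    refine (norm_integral_le_of_norm_le_const (μ := P z)
      (f := fun x => V x - (1 / (k + 1 : ℝ)) * (⌊(k + 1 : ℝ) * V x⌋₊ : ℝ)) (ae_of_all _ hb)).trans ?_
    simp
  -- By compactness a subsequence of the weights converges; the limit is chosen before `z`, so it
  -- serves all `z` at once.
  obtain ⟨a, ha, g, hg, hlim⟩ :=
    (isCompact_closedBall (0 : EuclideanSpace ℝ (Fin d)) (r * M)).tendsto_subseq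
      (x := w) fun k => by simpa using hwr k
  refine ⟨a, by simpa using ha, fun z => ?_⟩
  have h1 : Filter.Tendsto (fun k => inner ℝ (φ z) (w (g k))) Filter.atTop
      (nhds (inner ℝ (φ z) a)) := Filter.Tendsto.inner tendsto_const_nhds hlim
  have h2 : Filter.Tendsto (fun k => inner ℝ (φ z) (w (g k))) Filter.atTop
      (nhds (∫ x, V x ∂(P z))) := by
    rw [tendsto_iff_dist_tendsto_zero]
    refine squeeze_zero (fun _ => dist_nonneg) (fun k => ?_)
      ((tendsto_one_div_add_atTop_nhds_zero_nat (𝕜 := ℝ)).comp hg.tendsto_atTop)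
    rw [dist_comm, Real.dist_eq]
    exact hwz (g k) z
  exact tendsto_nhds_unique h2 h1

end LinearTransition

/-! ### Values of matrix games. -/

section MatrixGames

variable {A B : Type*} [Fintype A] [Fintype B]

/-- The (lower) value of the matrix game `Q`. -/
def matVal (Q : A → B → ℝ) : ℝ :=
  ⨆ p : stdSimplex ℝ A, ⨅ q : stdSimplex ℝ B, payoff Q p.1 q.1

theorem payoff_mem_Icc {Q : A → B → ℝ} {p : A → ℝ} {q : B → ℝ} (hp : p ∈ stdSimplex ℝ A)
    (hq : q ∈ stdSimplex ℝ B) {l u : ℝ} (h : ∀ a b, Q a b ∈ Set.Icc l u) :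
    payoff Q p q ∈ Set.Icc l u := by
  constructor
  · exact (payoff_const hp hq l).ge.trans (payoff_mono hp hq fun a b => (h a b).1)
  · exact (payoff_mono hp hq fun a b => (h a b).2).trans (payoff_const hp hq u).le

theorem exists_payoff_mem_Icc (Q : A → B → ℝ) :
    ∃ C : ℝ, ∀ (p : stdSimplex ℝ A) (q : stdSimplex ℝ B), payoff Q p.1 q.1 ∈ Set.Icc (-C) C := by
  refine ⟨‖Q‖, fun p q => payoff_mem_Icc p.2 q.2 fun a b => ?_⟩
  refine Set.mem_Icc.mpr (abs_le.mp ?_)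
  exact (norm_le_pi_norm (Q a) b).trans (norm_le_pi_norm Q a)

theorem bddBelow_payoff (Q : A → B → ℝ) (p : stdSimplex ℝ A) :
    BddBelow (Set.range fun q : stdSimplex ℝ B => payoff Q p.1 q.1) := by
  obtain ⟨C, hC⟩ := exists_payoff_mem_Icc Q
  exact ⟨-C, by rintro _ ⟨q, rfl⟩; exact (hC p q).1⟩

theorem bddAbove_iInf_payoff [Nonempty B] (Q : A → B → ℝ) :
    BddAbove (Set.range fun p : stdSimplex ℝ A => ⨅ q : stdSimplex ℝ B, payoff Q p.1 q.1) := by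
  obtain ⟨C, hC⟩ := exists_payoff_mem_Icc Q
  refine ⟨C, ?_⟩
  rintro _ ⟨p, rfl⟩
  obtain ⟨q⟩ : Nonempty (stdSimplex ℝ B) := inferInstance
  exact (ciInf_le (bddBelow_payoff Q p) q).trans (hC p q).2

/-- A saddle point attains the max-min value, so the payoff depends on `Q` alone. This removes the
arbitrary choice of equilibria from the value estimates. -/
theorem IsMatrixNash.payoff_eq {Q : A → B → ℝ} {p : A → ℝ} {q : B → ℝ}
    (h : IsMatrixNash Q p q) : payoff Q p q = matVal Q := by
  obtain ⟨hp, hq, h1, h2⟩ := h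
  have : Nonempty (stdSimplex ℝ A) := ⟨⟨p, hp⟩⟩
  have : Nonempty (stdSimplex ℝ B) := ⟨⟨q, hq⟩⟩
  have : Nonempty B := by
    by_contra hB
    rw [not_nonempty_iff] at hB
    simpa using hq.2
  refine le_antisymm ?_ (ciSup_le fun p' => ?_)
  · exact (le_ciInf fun q' : stdSimplex ℝ B => h2 q' q'.2).trans
      (le_ciSup (bddAbove_iInf_payoff Q) (⟨p, hp⟩ : stdSimplex ℝ A))
  · exact (ciInf_le (bddBelow_payoff Q p') (⟨q, hq⟩ : stdSimplex ℝ B)).trans (h1 p' p'.2)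

/-- Entrywise `Q ≤ Q' + dist Q Q'`, and payoffs under mixed strategies are monotone and commute with
adding constants. The purpose is measurability of the value. -/
theorem lipschitzWith_matVal [Nonempty A] [Nonempty B] :
    LipschitzWith 1 (matVal : (A → B → ℝ) → ℝ) := by
  refine LipschitzWith.of_le_add fun Q Q' => ciSup_le fun p => ?_
  rw [← sub_le_iff_le_add]
  refine le_trans (le_ciInf fun q => ?_) (le_ciSup (bddAbove_iInf_payoff Q') p)
  rw [sub_le_iff_le_add]
  refine (ciInf_le (bddBelow_payoff Q p) q).trans ?_
  rw [← payoff_const p.2 q.2 (dist Q Q'), ← payoff_add]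
  refine payoff_mono p.2 q.2 fun a b => ?_
  have h1 : dist (Q a b) (Q' a b) ≤ dist Q Q' :=
    (dist_le_pi_dist (Q a) (Q' a) b).trans (dist_le_pi_dist Q Q' a)
  rw [Real.dist_eq] at h1
  linarith [le_abs_self (Q a b - Q' a b)]

theorem measurable_matVal [Nonempty A] [Nonempty B] :
    Measurable (matVal : (A → B → ℝ) → ℝ) :=
  lipschitzWith_matVal.continuous.measurable

end MatrixGames

/-! ### Measurability of Gram matrices and norms. -/

section Measurability

open Matrix

variable {d : ℕ} {ι Ω : Type*} [MeasurableSpace Ω]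

/-- Entries of the inverse are determinant inverse times adjugate; the convention `0⁻¹ = 0` covers
singular matrices. -/
theorem measurable_matrix_inv {M : Ω → Matrix (Fin d) (Fin d) ℝ}
    (hM : ∀ i j, Measurable fun ω => M ω i j) (i j : Fin d) :
    Measurable fun ω => (M ω)⁻¹ i j := by
  have h0 : Measurable fun ω i j => M ω i j :=
    measurable_pi_iff.mpr fun i => measurable_pi_iff.mpr fun j => hM i j
  have hc : Continuous fun f : Fin d → Fin d → ℝ => Matrix.of f :=
    continuous_matrix fun i j => by fun_prop
  have h1 : Continuous fun f : Fin d → Fin d → ℝ => (Matrix.of f).det := hc.matrix_det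
  have h2 : Continuous fun f : Fin d → Fin d → ℝ => (Matrix.of f).adjugate i j :=
    hc.matrix_adjugate.matrix_elem i j
  have h3 : (fun ω => (M ω)⁻¹ i j) = fun ω => ((M ω).det)⁻¹ * (M ω).adjugate i j := by
    funext ω
    rw [Matrix.inv_def, Matrix.smul_apply, Ring.inverse_eq_inv', smul_eq_mul]
  rw [h3]
  exact (h1.measurable.comp h0).inv.mul (h2.measurable.comp h0)

theorem measurable_ofLp_apply {u : Ω → EuclideanSpace ℝ (Fin d)} (hu : Measurable u) (i : Fin d) :
    Measurable fun ω => (u ω).ofLp i :=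
  (EuclideanSpace.proj (𝕜 := ℝ) i).continuous.measurable.comp hu

theorem measurable_regGram_inv (s : Finset ι) {f : ι → Ω → EuclideanSpace ℝ (Fin d)}
    (hf : ∀ τ, Measurable (f τ)) (i j : Fin d) :
    Measurable fun ω => (regGram s fun τ => f τ ω)⁻¹ i j := by
  refine measurable_matrix_inv (fun i j => ?_) i j
  simp only [regGram, Matrix.add_apply, Matrix.sum_apply, vecMulVec_apply]
  refine Measurable.add (Finset.measurable_sum _ fun τ _ => ?_) measurable_const
  exact (measurable_ofLp_apply (hf τ) i).mul (measurable_ofLp_apply (hf τ) j)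

theorem measurable_dotProduct_mulVec {M : Ω → Matrix (Fin d) (Fin d) ℝ}
    (hM : ∀ i j, Measurable fun ω => M ω i j) {u v : Ω → Fin d → ℝ}
    (hu : ∀ i, Measurable fun ω => u ω i) (hv : ∀ i, Measurable fun ω => v ω i) :
    Measurable fun ω => u ω ⬝ᵥ M ω *ᵥ v ω := by
  simp only [dotProduct, mulVec]
  exact Finset.measurable_sum _ fun i _ => (hu i).mul
    (Finset.measurable_sum _ fun j _ => (hM i j).mul (hv j))

theorem measurable_matNorm_regGram_inv (s : Finset ι) {f : ι → Ω → EuclideanSpace ℝ (Fin d)}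
    (hf : ∀ τ, Measurable (f τ)) {u : Ω → EuclideanSpace ℝ (Fin d)} (hu : Measurable u) :
    Measurable fun ω => matNorm (regGram s fun τ => f τ ω)⁻¹ (u ω) :=
  (measurable_dotProduct_mulVec (measurable_regGram_inv s hf) (measurable_ofLp_apply hu)
    (measurable_ofLp_apply hu)).sqrt

end Measurability

/-! ### Clipped Q-estimates with a signed bonus. -/

section Clipping

open Matrix hiding gram

variable {S A B : Type*} {H K d : ℕ}

/-- Allowing negative multipliers lets one treatment of the estimates serve for both the lower and
the upper ones. -/
theorem lowerQ_eq_upperQ_neg (φ : S × A × B → EuclideanSpace ℝ (Fin d)) (fold : Fin K → Fin H)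
    (lam β : ℝ) (D : Fin K → Fin H → Sample S A B) (h : Fin H) (V : S → ℝ) :
    lowerQ φ fold lam β D h V = upperQ φ fold lam (-β) D h V := by
  funext z
  simp [lowerQ, upperQ, bonus, sub_eq_add_neg]

theorem upperQ_mem_Icc (φ : S × A × B → EuclideanSpace ℝ (Fin d)) (fold : Fin K → Fin H)
    (lam β : ℝ) (D : Fin K → Fin H → Sample S A B) (h : Fin H) (V : S → ℝ) (z : S × A × B) :
    upperQ φ fold lam β D h V z ∈ Set.Icc 0 ((H : ℝ) - h) := by
  have : (h : ℝ) ≤ H := by exact_mod_cast h.2.le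
  exact ⟨le_max_left _ _, max_le (by linarith) (min_le_right _ _)⟩

theorem gram_eq_regGram (φ : S × A × B → EuclideanSpace ℝ (Fin d)) (fold : Fin K → Fin H)
    (D : Fin K → Fin H → Sample S A B) (h : Fin H) :
    gram φ fold 1 D h = regGram {τ | fold τ = h} fun τ => φ (D τ h).sa := by
  simp [gram, regGram]

/-- `W` is a sequence of value estimates that SPMVI may compute with the signed bonus multiplier
`β`. -/
def IsValueEstimate [Fintype A] [Fintype B] (φ : S × A × B → EuclideanSpace ℝ (Fin d))
    (fold : Fin K → Fin H) (β : ℝ) (D : Fin K → Fin H → Sample S A B) (W : ℕ → S → ℝ) : Prop :=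
  (∀ x, W H x = 0) ∧ ∀ (h : Fin H) (x : S), ∃ p q,
    IsMatrixNash (fun a b => upperQ φ fold 1 β D h (W (h + 1)) (x, a, b)) p q ∧
      W h x = payoff (fun a b => upperQ φ fold 1 β D h (W (h + 1)) (x, a, b)) p q

theorem IsValueEstimate.mem_Icc [Fintype A] [Fintype B]
    {φ : S × A × B → EuclideanSpace ℝ (Fin d)} {fold : Fin K → Fin H} {β : ℝ}
    {D : Fin K → Fin H → Sample S A B} {W : ℕ → S → ℝ} (hW : IsValueEstimate φ fold β D W)
    {h : ℕ} (hh : h ≤ H) (x : S) : W h x ∈ Set.Icc 0 ((H : ℝ) - h) := by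
  rcases hh.eq_or_lt with rfl | hlt
  · simp [hW.1]
  · obtain ⟨p, q, hN, he⟩ := hW.2 ⟨h, hlt⟩ x
    rw [show W h x = _ from he]
    exact payoff_mem_Icc hN.1 hN.2.1 fun a b => upperQ_mem_Icc φ fold 1 β D ⟨h, hlt⟩ _ _

end Clipping

/-! ### Value estimates as measurable functions of the data. -/

section Estimates

open Matrix hiding gram

variable {S A B : Type*} [MeasurableSpace S] [MeasurableSpace A] [MeasurableSpace B]
  {H K d : ℕ}

theorem SPMVIRun.IsRunOn.isValueEstimate_upV [Fintype A] [Fintype B] {R : SPMVIRun S A B}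
    {φ : S × A × B → EuclideanSpace ℝ (Fin d)} {fold : Fin K → Fin H} {β : ℝ}
    {D : Fin K → Fin H → Sample S A B} (hR : R.IsRunOn φ fold 1 β D) :
    IsValueEstimate φ fold β D R.upV :=
  ⟨hR.upV_last, fun h x => ⟨_, _, hR.upper_nash h x, hR.upV_eq h x⟩⟩

theorem SPMVIRun.IsRunOn.isValueEstimate_loV [Fintype A] [Fintype B] {R : SPMVIRun S A B}
    {φ : S × A × B → EuclideanSpace ℝ (Fin d)} {fold : Fin K → Fin H} {β : ℝ}
    {D : Fin K → Fin H → Sample S A B} (hR : R.IsRunOn φ fold 1 β D) :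
    IsValueEstimate φ fold (-β) D R.loV := by
  refine ⟨hR.loV_last, fun h x => ⟨R.πHat.prob h x, R.νAux.prob h x, ?_, ?_⟩⟩
  · simpa only [lowerQ_eq_upperQ_neg] using hR.lower_nash h x
  · simpa only [lowerQ_eq_upperQ_neg] using hR.loV_eq h x

theorem upperQ_congr (G : MarkovGame S A B) (φ : S × A × B → EuclideanSpace ℝ (Fin d))
    (fold : Fin K → Fin H) (β : ℝ) (h : Fin H) (V : S → ℝ)
    {ω ω' : Fin K → Fin H → Transition S A B} (hω : ∀ τ, fold τ = h → ω τ = ω' τ) :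
    upperQ φ fold 1 β (G.observe ω) h V = upperQ φ fold 1 β (G.observe ω') h V := by
  have h1 : gram φ fold 1 (G.observe ω) h = gram φ fold 1 (G.observe ω') h := by
    rw [gram, gram]
    congr 1
    refine Finset.sum_congr rfl fun τ hτ => ?_
    simp only [MarkovGame.observe, hω τ (Finset.mem_filter.mp hτ).2]
  have h2 : ridge φ fold 1 (G.observe ω) h V = ridge φ fold 1 (G.observe ω') h V := by
    rw [ridge, ridge, h1]
    congr 1
    refine Finset.sum_congr rfl fun τ hτ => ?_
    simp only [MarkovGame.observe, hω τ (Finset.mem_filter.mp hτ).2]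
  funext z
  simp only [upperQ, bonus, h1, h2]

theorem measurable_upperQ (G : MarkovGame S A B) {φ : S × A × B → EuclideanSpace ℝ (Fin d)}
    (hφ : Measurable φ) (fold : Fin K → Fin H) (β : ℝ) (h : Fin H)
    {V : (Fin K → Fin H → Transition S A B) → S → ℝ} (hV : Measurable (Function.uncurry V))
    (a : A) (b : B) :
    Measurable fun q : (Fin K → Fin H → Transition S A B) × S =>
      upperQ φ fold 1 β (G.observe q.1) h (V q.1) (q.2, a, b) := by
  have hφτ : ∀ τ, Measurable fun q : (Fin K → Fin H → Transition S A B) × S =>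
      φ (q.1 τ h).1 := fun τ => by fun_prop
  have hu : Measurable fun q : (Fin K → Fin H → Transition S A B) × S => φ (q.2, a, b) := by
    fun_prop
  have hV' : ∀ τ, Measurable fun q : (Fin K → Fin H → Transition S A B) × S =>
      V q.1 (q.1 τ h).2 := fun τ =>
    hV.comp (f := fun q : (Fin K → Fin H → Transition S A B) × S => (q.1, (q.1 τ h).2))
      (by fun_prop)
  have hr : ∀ τ, Measurable fun q : (Fin K → Fin H → Transition S A B) × S =>
      G.r h (q.1 τ h).1 := fun τ => (G.measurable_r h).comp (by fun_prop)
  simp only [upperQ, ridge, bonus, gram_eq_regGram, MarkovGame.observe]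
  refine measurable_const.max (Measurable.min (Measurable.add ?_ ?_) measurable_const)
  · refine measurable_dotProduct_mulVec (measurable_regGram_inv _ hφτ)
      (measurable_ofLp_apply hu) fun i => ?_
    simp only [Finset.sum_apply, Pi.smul_apply, smul_eq_mul]
    exact Finset.measurable_sum _ fun τ _ =>
      ((hr τ).add (hV' τ)).mul (measurable_ofLp_apply (hφτ τ) i)
  · exact measurable_const.mul (measurable_matNorm_regGram_inv _ hφτ hu)

/-- The value estimates do not depend on the choice of the equilibria; they are measurable in the
data, and the estimate of step `h` only depends on the folds from `h` on. -/
theorem exists_measurable_estimate [Fintype A] [Nonempty A] [MeasurableSingletonClass A]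
    [Fintype B] [Nonempty B] [MeasurableSingletonClass B] (G : MarkovGame S A B)
    {φ : S × A × B → EuclideanSpace ℝ (Fin d)} (hφ : Measurable φ) (fold : Fin K → Fin H) (β : ℝ)
    {h : ℕ} (hh : h ≤ H) :
    ∃ V : (Fin K → Fin H → Transition S A B) → S → ℝ, Measurable (Function.uncurry V) ∧
      (∀ ω ω', (∀ τ, h ≤ fold τ → ω τ = ω' τ) → V ω = V ω') ∧
      (∀ ω x, V ω x ∈ Set.Icc (0 : ℝ) H) ∧
      ∀ ω W, IsValueEstimate φ fold β (G.observe ω) W → W h = V ω := by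
  induction hh using Nat.decreasingInduction with
  | self =>
    exact ⟨fun _ _ => 0, measurable_const, fun _ _ _ => rfl, fun _ _ => by simp,
      fun ω W hW => funext hW.1⟩
  | of_succ h hh ih =>
    obtain ⟨V, hVm, hVdep, -, hVeq⟩ := ih
    -- The clamping to `[0, H]` makes the range condition hold by construction; it does not alter
    -- actual estimates, which already lie in that interval.
    refine ⟨fun ω x => min H (max 0 (matVal fun a b =>
      upperQ φ fold 1 β (G.observe ω) ⟨h, hh⟩ (V ω) (x, a, b))), ?_, ?_, ?_, ?_⟩
    · refine measurable_const.min (measurable_const.max (measurable_matVal.comp ?_))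
      exact measurable_pi_iff.mpr fun a => measurable_pi_iff.mpr fun b =>
        measurable_upperQ G hφ fold β ⟨h, hh⟩ hVm a b
    · intro ω ω' hω
      beta_reduce
      rw [hVdep ω ω' fun τ hτ => hω τ (by omega),
        upperQ_congr G φ fold β ⟨h, hh⟩ (V ω') fun τ hτ => hω τ (by rw [hτ])]
    · exact fun ω x => ⟨le_min (Nat.cast_nonneg _) (le_max_left _ _), min_le_left _ _⟩
    · intro ω W hW
      funext x
      obtain ⟨p, q, hN, he⟩ := hW.2 ⟨h, hh⟩ x
      have h1 := hW.mem_Icc hh.le x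
      have h2 : W h x = matVal fun a b =>
          upperQ φ fold 1 β (G.observe ω) ⟨h, hh⟩ (V ω) (x, a, b) := by
        rw [← hVeq ω W hW, ← hN.payoff_eq]
        exact he
      beta_reduce
      rw [← h2, max_eq_right h1.1, min_eq_right]
      linarith [h1.2, (Nat.cast_nonneg h : (0 : ℝ) ≤ h)]

end Estimates

/-! ### Concentration of the noise in the dataset. -/

section DataNoise

open Matrix hiding gram

variable {S A B : Type*} [MeasurableSpace S] [MeasurableSpace A] [MeasurableSpace B]
  {H K d : ℕ}

instance MarkovGame.isProbabilityMeasure_trajLaw (G : MarkovGame S A B) (ρ : Measure S)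
    [IsProbabilityMeasure ρ] (b : Policy S (A × B)) (H : ℕ) :
    IsProbabilityMeasure (G.trajLaw ρ b H) := by
  unfold MarkovGame.trajLaw
  infer_instance

/-- Concentration of the noise of the regression of step `h`, for a value estimate computed from
the trajectories of the other folds. -/
theorem MarkovGame.measure_noise_le (G : MarkovGame S A B) (ρ : Measure S)
    [IsProbabilityMeasure ρ] (b : Policy S (A × B)) {φ : S × A × B → EuclideanSpace ℝ (Fin d)}
    (hφ : Measurable φ) (fold : Fin K → Fin H) (h : Fin H)
    {V : (Fin K → Fin H → Transition S A B) → S → ℝ} (hVm : Measurable (Function.uncurry V))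
    (hVdep : ∀ ω ω', (∀ τ, fold τ ≠ h → ω τ = ω' τ) → V ω = V ω') {M : ℝ}
    (hV : ∀ ω x, V ω x ∈ Set.Icc 0 M) {t : ℝ} (ht : 0 ≤ t) :
    G.dataLaw ρ b H K {ω | √d * t < matNorm (gram φ fold 1 (G.observe ω) h)⁻¹
        (∑ τ with fold τ = h, (V ω (ω τ h).2 - ∫ y, V ω y ∂(G.P h (ω τ h).1)) •
          φ (ω τ h).1)} ≤
      ENNReal.ofReal (d * (2 * Real.exp (-(2 * t ^ 2 / M ^ 2)))) := by
  simp only [gram_eq_regGram, MarkovGame.observe, MarkovGame.dataLaw]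
  have hφτ : ∀ τ, Measurable fun ω : Fin K → Fin H → Transition S A B => φ (ω τ h).1 :=
    fun τ => by fun_prop
  -- Freeze the trajectories of the other folds at `y`. The value function becomes the deterministic
  -- `V y`, and only transitions of step `h` matter.
  refine measure_pi_le_of_forall_ite (G.trajLaw ρ b H) (fun τ => fold τ = h) ?_ fun y => ?_
  · refine measurableSet_lt measurable_const (measurable_matNorm_regGram_inv _ hφτ ?_)
    refine Finset.measurable_sum _ fun τ _ => Measurable.fun_smul (Measurable.fun_sub ?_ ?_) (hφτ τ)
    · exact hVm.comp (f := fun ω : Fin K → Fin H → Transition S A B => (ω, (ω τ h).2))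
        (by fun_prop)
    · exact (StronglyMeasurable.integral_kernel_prod_right'
        (κ := (G.P h).comap (fun ω : Fin K → Fin H → Transition S A B => (ω τ h).1)
          (by fun_prop)) hVm.stronglyMeasurable).measurable
  · have hVy : ∀ ω : Fin K → Fin H → Transition S A B,
        V (fun τ => if fold τ = h then ω τ else y τ) = V y := fun ω =>
      hVdep _ _ fun τ hτ => by simp [hτ]
    have hVym : Measurable (V y) := hVm.comp measurable_prodMk_left
    set E : Set (Fin K → Transition S A B) := {q | √d * t <
      matNorm (regGram {τ | fold τ = h} fun τ => φ (q τ).1)⁻¹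
        (∑ τ with fold τ = h, (V y (q τ).2 - ∫ x, V y x ∂(G.P h (q τ).1)) • φ (q τ).1)} with hE
    have hφq : ∀ τ, Measurable fun q : Fin K → Transition S A B => φ (q τ).1 :=
      fun τ => by fun_prop
    have hEm : MeasurableSet E := by
      refine measurableSet_lt measurable_const (measurable_matNorm_regGram_inv _ hφq ?_)
      refine Finset.measurable_sum _ fun τ _ => Measurable.fun_smul (Measurable.fun_sub ?_ ?_) (hφq τ)
      · exact hVym.comp (by fun_prop)
      · exact ((hVym.stronglyMeasurable.integral_kernel (κ := G.P h)).measurable).comp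
          (g := fun z => ∫ x, V y x ∂(G.P h z))
          (by fun_prop : Measurable fun q : Fin K → Transition S A B => (q τ).1)
    have hset : {ω : Fin K → Fin H → Transition S A B |
        (fun τ => if fold τ = h then ω τ else y τ) ∈
          {ω : Fin K → Fin H → Transition S A B | √d * t <
            matNorm (regGram {τ | fold τ = h} fun τ => φ (ω τ h).1)⁻¹
              (∑ τ with fold τ = h, (V ω (ω τ h).2 - ∫ y, V ω y ∂(G.P h (ω τ h).1)) •
                φ (ω τ h).1)}} =
        (fun (ω : Fin K → Fin H → Transition S A B) τ => ω τ h) ⁻¹' E := by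
      ext ω
      have e1 : (regGram {τ | fold τ = h} fun τ => φ ((if fold τ = h then ω τ else y τ) h).1) =
          regGram {τ | fold τ = h} fun τ => φ (ω τ h).1 := by
        rw [regGram, regGram]
        congr 1
        exact Finset.sum_congr rfl fun τ hτ => by rw [if_pos (Finset.mem_filter.mp hτ).2]
      have e2 : (∑ τ with fold τ = h, (V y ((if fold τ = h then ω τ else y τ) h).2 -
            ∫ x, V y x ∂(G.P h ((if fold τ = h then ω τ else y τ) h).1)) •
              φ ((if fold τ = h then ω τ else y τ) h).1) =
          ∑ τ with fold τ = h, (V y (ω τ h).2 - ∫ x, V y x ∂(G.P h (ω τ h).1)) •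
            φ (ω τ h).1 :=
        Finset.sum_congr rfl fun τ hτ => by rw [if_pos (Finset.mem_filter.mp hτ).2]
      simp only [Set.mem_ofPred_eq, hVy, e1, e2, Set.mem_preimage, hE]
    have hm : Measurable fun ω : Fin H → Transition S A B => ω h := measurable_pi_apply h
    have hm1 : Measurable fun ω : Fin H → Transition S A B => (ω h).1 := by fun_prop
    have hmap := Measure.pi_map_pi (μ := fun _ : Fin K => G.trajLaw ρ b H)
      (f := fun _ ω => ω h) fun _ => hm.aemeasurable
    have : IsProbabilityMeasure ((G.trajLaw ρ b H).map fun ω => (ω h).1) :=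
      Measure.isProbabilityMeasure_map hm1.aemeasurable
    have hmE : Measurable fun (ω : Fin K → Fin H → Transition S A B) τ => ω τ h :=
      measurable_pi_iff.mpr fun τ => hm.comp (measurable_pi_apply τ)
    rw [hset, ← Measure.map_apply hmE hEm, hmap]
    simp only [G.trajLaw_map_eval ρ b h]
    -- Freezing the states and actions `z` as well makes the features deterministic and leaves only
    -- the next states random.
    refine measure_pi_compProd_le _ _ hEm fun z => ?_
    exact measure_matNorm_noise_le (fun τ => G.P h (z τ)) hVym (hV y) _ (fun τ => φ (z τ)) ht

end DataNoise

/-! ### Lower bounds on Gram matrices from a grid of directions. -/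

section Coverage

open Matrix hiding gram
open scoped MatrixOrder

/-- Subtracting the smallest eigenvalue times the identity shifts the spectrum to the nonnegative
half-line, so the difference is positive semidefinite. -/
theorem Matrix.IsHermitian.minEigenvalue_mul_le {d : ℕ} {M : Matrix (Fin d) (Fin d) ℝ}
    (hM : M.IsHermitian) (v : Fin d → ℝ) :
    minEigenvalue M * (v ⬝ᵥ v) ≤ v ⬝ᵥ M *ᵥ v := by
  have hb : BddBelow (spectrum ℝ M) := by
    rw [hM.spectrum_real_eq_range_eigenvalues]
    exact (Set.finite_range _).bddBelow
  have h1 : (M - algebraMap ℝ _ (minEigenvalue M)).PosSemidef := by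
    rw [posSemidef_iff_isHermitian_and_spectrum_nonneg]
    refine ⟨hM.sub ?_, fun x hx => ?_⟩
    · rw [algebraMap_eq_diagonal]
      exact isHermitian_diagonal _
    · rw [sub_eq_neg_add, ← spectrum.add_mem_iff (s := minEigenvalue M)] at hx
      have := csInf_le hb hx
      rw [← minEigenvalue] at this
      simpa using this
  have h2 := h1.dotProduct_mulVec_nonneg v
  rw [star_trivial, sub_mulVec, dotProduct_sub, Algebra.algebraMap_eq_smul_one, smul_mulVec,
    one_mulVec, dotProduct_smul, smul_eq_mul] at h2
  linarith

/-- The points of a grid on the cube `[-1, 1]^d`. -/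
def gridPoint {d m : ℕ} (k : Fin d → Fin (2 * m + 1)) : Fin d → ℝ := fun i => (k i : ℝ) / m - 1

theorem exists_gridPoint {d m : ℕ} (hm : 0 < m) (v : Fin d → ℝ) (hv : ∀ i, |v i| ≤ 1) :
    ∃ k : Fin d → Fin (2 * m + 1),
      (v - gridPoint k) ⬝ᵥ (v - gridPoint k) ≤ d / (m : ℝ) ^ 2 := by
  have hm' : (0 : ℝ) < m := by exact_mod_cast hm
  have h0 : ∀ i, 0 ≤ (v i + 1) * m := fun i =>
    mul_nonneg (by linarith [(abs_le.mp (hv i)).1]) hm'.le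
  have hk : ∀ i, ⌊(v i + 1) * m⌋₊ < 2 * m + 1 := fun i => by
    rw [Nat.lt_succ_iff]
    refine Nat.floor_le_of_le ?_
    push_cast
    have := (abs_le.mp (hv i)).2
    gcongr
    linarith
  refine ⟨fun i => ⟨⌊(v i + 1) * m⌋₊, hk i⟩, ?_⟩
  have hi : ∀ i, (v i - gridPoint (fun i => ⟨⌊(v i + 1) * m⌋₊, hk i⟩) i) *
      (v i - gridPoint (fun i => ⟨⌊(v i + 1) * m⌋₊, hk i⟩) i) ≤ 1 / (m : ℝ) ^ 2 := fun i => by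
    have h1 := Nat.floor_le (h0 i)
    have h2 := Nat.lt_floor_add_one ((v i + 1) * m)
    have e : v i - gridPoint (fun i => ⟨⌊(v i + 1) * m⌋₊, hk i⟩) i =
        ((v i + 1) * m - ⌊(v i + 1) * m⌋₊) / m := by
      simp only [gridPoint]
      field_simp
      ring
    rw [e, ← sq, div_pow]
    gcongr
    rw [sq_le_one_iff_abs_le_one, abs_le]
    constructor <;> linarith
  calc _ ≤ ∑ i : Fin d, 1 / (m : ℝ) ^ 2 := Finset.sum_le_sum fun i _ => hi i
    _ = d / (m : ℝ) ^ 2 := by simp [div_eq_mul_inv]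

theorem dotProduct_sq_le {d : ℕ} (f : EuclideanSpace ℝ (Fin d)) (hf : ‖f‖ ≤ 1) (v : Fin d → ℝ) :
    (f.ofLp ⬝ᵥ v) ^ 2 ≤ v ⬝ᵥ v := by
  have h1 := abs_real_inner_le_norm f (WithLp.toLp 2 v)
  have h2 : inner ℝ f (WithLp.toLp 2 v) = f.ofLp ⬝ᵥ v := by
    rw [← WithLp.toLp_ofLp 2 f, EuclideanSpace.inner_toLp_toLp, star_trivial, dotProduct_comm]
  rw [h2] at h1
  rw [← norm_toLp_sq, ← sq_abs]
  gcongr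
  exact h1.trans (mul_le_of_le_one_left (norm_nonneg _) hf)

/-- A lower bound on the regularized Gram matrix, from lower bounds in the directions of a grid. -/
theorem regGram_ge_of_grid {d : ℕ} {ι : Type*} {s : Finset ι} {f : ι → EuclideanSpace ℝ (Fin d)}
    (hf : ∀ τ, ‖f τ‖ ≤ 1) (hs : 0 < s.card) {κ : ℝ}
    (hgrid : ∀ k : Fin d → Fin (2 * (2 * d * s.card) + 1),
      1 / 4 ≤ gridPoint k ⬝ᵥ gridPoint k → gridPoint k ⬝ᵥ gridPoint k ≤ 4 →
        s.card * κ / 16 ≤ ∑ τ ∈ s, ((f τ).ofLp ⬝ᵥ gridPoint k) ^ 2)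
    (v : Fin d → ℝ) : s.card * κ / 32 * (v ⬝ᵥ v) ≤ v ⬝ᵥ regGram s f *ᵥ v := by
  have hunit : ∀ v : Fin d → ℝ, v ⬝ᵥ v = 1 → s.card * κ / 32 ≤ v ⬝ᵥ regGram s f *ᵥ v := by
    intro v hv
    have hd : 0 < d := by
      rcases Nat.eq_zero_or_pos d with rfl | h
      · simp at hv
      · exact h
    have hvi : ∀ i, |v i| ≤ 1 := fun i => by
      rw [← sq_le_one_iff_abs_le_one, ← hv, sq]
      exact Finset.single_le_sum (f := fun i => v i * v i) (fun j _ => mul_self_nonneg (v j))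
        (Finset.mem_univ i)
    -- This mesh makes `s.card` times the squared rounding error at most `1 / 4`, in any dimension.
    obtain ⟨k, hk⟩ := exists_gridPoint (m := 2 * d * s.card) (by positivity) v hvi
    set g := gridPoint k with hg
    set e := v - g with he
    have hd1 : (1 : ℝ) ≤ d := by exact_mod_cast hd
    have hn1 : (1 : ℝ) ≤ s.card := by exact_mod_cast hs
    have hee : s.card * (e ⬝ᵥ e) ≤ 1 / 4 := by
      calc _ ≤ s.card * ((d : ℝ) / ((2 * d * s.card : ℕ) : ℝ) ^ 2) := by gcongr
        _ = 1 / (4 * (d * s.card)) := by push_cast; field_simp; ring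
        _ ≤ 1 / (4 * (1 * 1)) := by gcongr
        _ = 1 / 4 := by norm_num
    have hee0 : 0 ≤ e ⬝ᵥ e := by rw [← norm_toLp_sq]; positivity
    have hee1 : e ⬝ᵥ e ≤ 1 / 4 := by nlinarith
    have hgg : 1 / 4 ≤ g ⬝ᵥ g ∧ g ⬝ᵥ g ≤ 4 := by
      have hve : ‖WithLp.toLp 2 v‖ = 1 := by
        rw [← sq_eq_sq₀ (norm_nonneg _) zero_le_one, norm_toLp_sq, hv, one_pow]
      have hen : ‖WithLp.toLp 2 e‖ ≤ 1 / 2 := by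
        refine abs_le_of_sq_le_sq' ?_ (by norm_num) |>.2
        rw [norm_toLp_sq]; linarith
      have hge : WithLp.toLp 2 g = WithLp.toLp 2 v - WithLp.toLp 2 e := by
        rw [← WithLp.toLp_sub, he, sub_sub_cancel]
      rw [← norm_toLp_sq, hge]
      have h1 := norm_sub_norm_le (WithLp.toLp 2 v) (WithLp.toLp 2 e)
      have h2 := norm_sub_le (WithLp.toLp 2 v) (WithLp.toLp 2 e)
      rw [hve] at h1 h2
      constructor <;> nlinarith
    have hG := hgrid k hgg.1 hgg.2
    have hpt : ∀ τ, ((f τ).ofLp ⬝ᵥ g) ^ 2 ≤ 2 * ((f τ).ofLp ⬝ᵥ v) ^ 2 + 2 * (e ⬝ᵥ e) := by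
      intro τ
      have h1 := dotProduct_sq_le (f τ) (hf τ) e
      have h2 : (f τ).ofLp ⬝ᵥ g = (f τ).ofLp ⬝ᵥ v - (f τ).ofLp ⬝ᵥ e := by
        rw [← dotProduct_sub, he, sub_sub_cancel]
      rw [h2]
      nlinarith [sq_nonneg ((f τ).ofLp ⬝ᵥ v + (f τ).ofLp ⬝ᵥ e)]
    have hsum := Finset.sum_le_sum fun τ (_ : τ ∈ s) => hpt τ
    rw [Finset.sum_add_distrib, ← Finset.mul_sum, Finset.sum_const, nsmul_eq_mul] at hsum
    -- The rounding contributes at most `1 / 4` after halving, which the identity in the regularized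
    -- Gram matrix absorbs since `v` is a unit vector.
    rw [dotProduct_regGram, hv]
    linarith
  rcases eq_or_ne v 0 with rfl | hv0
  · simp
  · set r := ‖WithLp.toLp 2 v‖ with hr
    have hr0 : 0 < r := by
      rw [hr, norm_pos_iff]
      exact fun h => hv0 (by simpa using congrArg WithLp.ofLp h)
    have h1 := hunit (r⁻¹ • v) (by
      rw [smul_dotProduct, dotProduct_smul, ← norm_toLp_sq, ← hr, smul_eq_mul, smul_eq_mul]
      field_simp)
    rw [mulVec_smul, smul_dotProduct, dotProduct_smul, smul_eq_mul, smul_eq_mul] at h1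
    rw [← norm_toLp_sq, ← hr]
    calc s.card * κ / 32 * r ^ 2 ≤ (r⁻¹ * (r⁻¹ * (v ⬝ᵥ regGram s f *ᵥ v))) * r ^ 2 := by gcongr
      _ = _ := by field_simp

end Coverage

/-! ### Coverage of the feature space by one fold. -/

section DataCoverage

open Matrix hiding gram

variable {S A B : Type*} [MeasurableSpace S] [MeasurableSpace A] [MeasurableSpace B]
  {H K d : ℕ}

theorem measurable_dotProduct_feature {φ : S × A × B → EuclideanSpace ℝ (Fin d)}
    (hφ : Measurable φ) (g : Fin d → ℝ) (h : Fin H) :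
    Measurable fun ω : Fin H → Transition S A B => ((φ (ω h).1).ofLp ⬝ᵥ g) ^ 2 := by
  have h1 : Measurable fun ω : Fin H → Transition S A B => φ (ω h).1 := by fun_prop
  simp only [dotProduct]
  exact (Finset.measurable_sum _ fun i _ =>
    (measurable_ofLp_apply h1 i).mul measurable_const).pow_const 2

theorem MarkovGame.coverage_mul_le (G : MarkovGame S A B) (ρ : Measure S)
    [IsProbabilityMeasure ρ] (b : Policy S (A × B)) {φ : S × A × B → EuclideanSpace ℝ (Fin d)}
    (hφ : Measurable φ) (hφ1 : ∀ z, ‖φ z‖ ≤ 1) (h : Fin H) (g : Fin d → ℝ) :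
    G.coverage ρ b H φ * (g ⬝ᵥ g) ≤ ∫ ω, ((φ (ω h).1).ofLp ⬝ᵥ g) ^ 2 ∂(G.trajLaw ρ b H) := by
  have hg0 : 0 ≤ g ⬝ᵥ g := by rw [← norm_toLp_sq]; positivity
  have h1 : G.coverage ρ b H φ ≤ minEigenvalue (G.featureCov ρ b φ h) :=
    ciInf_le (Set.finite_range _).bddBelow h
  have hherm : (G.featureCov ρ b φ h).IsHermitian := by
    ext i j
    simp only [MarkovGame.featureCov, conjTranspose_apply, of_apply, star_trivial]
    exact integral_congr_ae (ae_of_all _ fun ω => mul_comm _ _)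
  refine (mul_le_mul_of_nonneg_right h1 hg0).trans ((hherm.minEigenvalue_mul_le g).trans_eq ?_)
  have hφω : Measurable fun ω : Fin H → Transition S A B => φ (ω h).1 := by fun_prop
  have hint : ∀ i j, Integrable (fun ω : Fin H → Transition S A B =>
      φ (ω h).1 i * φ (ω h).1 j) (G.trajLaw ρ b H) := fun i j => by
    refine Integrable.of_bound ((measurable_ofLp_apply hφω i).mul
      (measurable_ofLp_apply hφω j)).aestronglyMeasurable 1 (ae_of_all _ fun ω => ?_)
    rw [norm_mul]
    have := fun i => (PiLp.norm_apply_le (φ (ω h).1) i).trans (hφ1 _)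
    exact mul_le_one₀ (this i) (norm_nonneg _) (this j)
  have h2 : ∀ ω : Fin H → Transition S A B, ((φ (ω h).1).ofLp ⬝ᵥ g) ^ 2 =
      ∑ i, ∑ j, g i * g j * (φ (ω h).1 i * φ (ω h).1 j) := fun ω => by
    rw [sq, dotProduct, Finset.sum_mul_sum]
    exact Finset.sum_congr rfl fun i _ => Finset.sum_congr rfl fun j _ => by ring
  simp only [h2]
  rw [integral_finsetSum _ fun i _ => integrable_finsetSum _ fun j _ => (hint i j).const_mul _]
  simp_rw [integral_finsetSum _ fun j (_ : j ∈ Finset.univ) => (hint _ j).const_mul _,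
    integral_const_mul]
  simp only [dotProduct, mulVec, MarkovGame.featureCov, of_apply, Finset.mul_sum]
  exact Finset.sum_congr rfl fun i _ => Finset.sum_congr rfl fun j _ => by ring

/-- It follows from `(1 + y) (1 - y / 2) ≥ 1` on `[0, 1]`. -/
theorem exp_neg_le_one_sub_half {y : ℝ} (h0 : 0 ≤ y) (h1 : y ≤ 1) :
    Real.exp (-y) ≤ 1 - y / 2 := by
  rw [Real.exp_neg, inv_le_iff_one_le_mul₀ (Real.exp_pos _)]
  have := Real.add_one_le_exp y
  nlinarith

/-- A multiplicative Chernoff bound for the data of one fold in one direction. -/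
theorem MarkovGame.measure_direction_le (G : MarkovGame S A B) (ρ : Measure S)
    [IsProbabilityMeasure ρ] (b : Policy S (A × B)) {φ : S × A × B → EuclideanSpace ℝ (Fin d)}
    (hφ : Measurable φ) (hφ1 : ∀ z, ‖φ z‖ ≤ 1) (h : Fin H) (s : Finset (Fin K))
    (hκ : 0 < G.coverage ρ b H φ) {g : Fin d → ℝ} (hg1 : 1 / 4 ≤ g ⬝ᵥ g) (hg2 : g ⬝ᵥ g ≤ 4) :
    G.dataLaw ρ b H K {ω | ∑ τ ∈ s, ((φ (ω τ h).1).ofLp ⬝ᵥ g) ^ 2 <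
        s.card * G.coverage ρ b H φ / 16} ≤
      ENNReal.ofReal (Real.exp (-(s.card * G.coverage ρ b H φ / 64))) := by
  set κ := G.coverage ρ b H φ with hκdef
  set X : (Fin H → Transition S A B) → ℝ := fun ω => ((φ (ω h).1).ofLp ⬝ᵥ g) ^ 2 with hX
  have hXm : Measurable X := measurable_dotProduct_feature hφ g h
  have hX0 : ∀ ω, 0 ≤ X ω := fun ω => sq_nonneg _
  have hX4 : ∀ ω, X ω ≤ 4 := fun ω => (dotProduct_sq_le _ (hφ1 _) g).trans hg2
  -- Dividing by `4` puts the exponent in `[0, 1]`. As `𝔼 X ≥ κ / 4`, the expectation is at most `1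
  -- - κ / 32`.
  have hone : ∫⁻ ω, ENNReal.ofReal (Real.exp (-(X ω / 4))) ∂(G.trajLaw ρ b H) ≤
      ENNReal.ofReal (Real.exp (-(κ / 32))) := by
    have hint : Integrable X (G.trajLaw ρ b H) :=
      Integrable.of_mem_Icc 0 4 hXm.aemeasurable (ae_of_all _ fun ω => ⟨hX0 ω, hX4 ω⟩)
    have hle : ∀ ω, Real.exp (-(X ω / 4)) ≤ 1 - X ω / 8 := fun ω => by
      refine (exp_neg_le_one_sub_half (by linarith [hX0 ω]) (by linarith [hX4 ω])).trans_eq ?_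
      ring
    calc _ ≤ ∫⁻ ω, ENNReal.ofReal (1 - X ω / 8) ∂(G.trajLaw ρ b H) :=
          lintegral_mono fun ω => ENNReal.ofReal_le_ofReal (hle ω)
      _ = ENNReal.ofReal (∫ ω, (1 - X ω / 8) ∂(G.trajLaw ρ b H)) := by
          rw [ofReal_integral_eq_lintegral_ofReal (f := fun ω => 1 - X ω / 8)
            ((integrable_const _).sub (hint.div_const 8))]
          exact ae_of_all _ fun ω => by
            simp only [Pi.zero_apply]
            linarith [hX4 ω]
      _ ≤ _ := by
          refine ENNReal.ofReal_le_ofReal ?_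
          rw [integral_sub (integrable_const _) (hint.div_const 8), integral_div]
          have h1 := G.coverage_mul_le ρ b hφ hφ1 h g
          have h2 := Real.add_one_le_exp (-(κ / 32))
          have h3 : κ * (1 / 4) ≤ κ * (g ⬝ᵥ g) := by gcongr
          simp only [integral_const, probReal_univ, smul_eq_mul, mul_one]
          linarith
  have hprod : ∫⁻ ω, ∏ τ ∈ s, ENNReal.ofReal (Real.exp (-(X (ω τ) / 4)))
      ∂(G.dataLaw ρ b H K) ≤ ENNReal.ofReal (Real.exp (-(κ / 32))) ^ s.card := by
    rw [MarkovGame.dataLaw, lintegral_pi_prod (fun _ => G.trajLaw ρ b H)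
      (f := fun _ ω => ENNReal.ofReal (Real.exp (-(X ω / 4))))
      (fun _ => ((hXm.div_const 4).neg.exp).ennreal_ofReal) s, Finset.prod_const]
    gcongr
  have hsub : {ω : Fin K → Fin H → Transition S A B |
        ∑ τ ∈ s, ((φ (ω τ h).1).ofLp ⬝ᵥ g) ^ 2 < s.card * κ / 16} ⊆
      {ω | ENNReal.ofReal (Real.exp (-(s.card * κ / 64))) ≤
        ∏ τ ∈ s, ENNReal.ofReal (Real.exp (-(X (ω τ) / 4)))} := fun ω hω => by
    rw [Set.mem_ofPred_eq] at hω ⊢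
    rw [← ENNReal.ofReal_prod_of_nonneg fun τ _ => (Real.exp_pos _).le, ← Real.exp_sum]
    refine ENNReal.ofReal_le_ofReal (Real.exp_le_exp.mpr ?_)
    rw [Finset.sum_neg_distrib, ← Finset.sum_div]
    simp only [hX]
    linarith
  -- On the bad event the product is at least `exp (-n κ / 64)`, while its mean is at most the
  -- square of this number; Markov leaves one factor.
  have hmarkov := mul_meas_ge_le_lintegral (μ := G.dataLaw ρ b H K)
    (f := fun ω => ∏ τ ∈ s, ENNReal.ofReal (Real.exp (-(X (ω τ) / 4))))
    (Finset.measurable_prod _ fun τ _ =>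
      (((hXm.div_const 4).neg.exp).ennreal_ofReal).comp (measurable_pi_apply τ))
    (ENNReal.ofReal (Real.exp (-(s.card * κ / 64))))
  have h5 := (mul_le_mul_right (measure_mono hsub) _).trans (hmarkov.trans hprod)
  rw [← ENNReal.ofReal_pow (Real.exp_pos _).le, ← Real.exp_nat_mul,
    show (s.card : ℝ) * -(κ / 32) = -(s.card * κ / 64) + -(s.card * κ / 64) by ring, Real.exp_add,
    ENNReal.ofReal_mul (Real.exp_pos _).le] at h5
  exact (ENNReal.mul_le_mul_iff_right (by simp [Real.exp_pos]) ENNReal.ofReal_ne_top).mp h5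

/-- A union bound over the `(4 d n + 1) ^ d` grid points, restricted to those of norm between `1 /
2` and `2`, where the Chernoff bound applies. -/
theorem MarkovGame.measure_gram_lt_le (G : MarkovGame S A B) (ρ : Measure S)
    [IsProbabilityMeasure ρ] (b : Policy S (A × B)) {φ : S × A × B → EuclideanSpace ℝ (Fin d)}
    (hφ : Measurable φ) (hφ1 : ∀ z, ‖φ z‖ ≤ 1) (fold : Fin K → Fin H) (h : Fin H) {n : ℕ}
    (hn : (Finset.univ.filter fun τ => fold τ = h).card = n) (hn0 : 0 < n)
    (hκ : 0 < G.coverage ρ b H φ) :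
    G.dataLaw ρ b H K {ω | ¬ ∀ v : Fin d → ℝ, n * G.coverage ρ b H φ / 32 * (v ⬝ᵥ v) ≤
        v ⬝ᵥ gram φ fold 1 (G.observe ω) h *ᵥ v} ≤
      ENNReal.ofReal ((4 * d * n + 1) ^ d * Real.exp (-(n * G.coverage ρ b H φ / 64))) := by
  set s := Finset.univ.filter fun τ => fold τ = h with hs
  subst hn
  set κ := G.coverage ρ b H φ with hκdef
  have hsub : {ω : Fin K → Fin H → Transition S A B | ¬ ∀ v : Fin d → ℝ,
        s.card * κ / 32 * (v ⬝ᵥ v) ≤ v ⬝ᵥ gram φ fold 1 (G.observe ω) h *ᵥ v} ⊆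
      ⋃ k ∈ Finset.univ.filter (fun k : Fin d → Fin (2 * (2 * d * s.card) + 1) =>
          1 / 4 ≤ gridPoint k ⬝ᵥ gridPoint k ∧ gridPoint k ⬝ᵥ gridPoint k ≤ 4),
        {ω | ∑ τ ∈ s, ((φ (ω τ h).1).ofLp ⬝ᵥ gridPoint k) ^ 2 < s.card * κ / 16} := by
    intro ω hω
    by_contra hcon
    simp only [Finset.mem_filter, Finset.mem_univ, true_and, Set.mem_iUnion, Set.mem_ofPred_eq,
      not_exists, not_lt] at hcon
    refine hω fun v => ?_
    rw [gram_eq_regGram]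
    exact regGram_ge_of_grid (fun τ => hφ1 _) hn0 (fun k h1 h2 => hcon k ⟨h1, h2⟩) v
  refine (measure_mono hsub).trans ((measure_biUnion_finset_le _ _).trans ?_)
  calc _ ≤ ∑ k ∈ Finset.univ.filter (fun k : Fin d → Fin (2 * (2 * d * s.card) + 1) =>
          1 / 4 ≤ gridPoint k ⬝ᵥ gridPoint k ∧ gridPoint k ⬝ᵥ gridPoint k ≤ 4),
          ENNReal.ofReal (Real.exp (-(s.card * κ / 64))) :=
        Finset.sum_le_sum fun k hk => by
          have := (Finset.mem_filter.mp hk).2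
          exact G.measure_direction_le ρ b hφ hφ1 h s hκ this.1 this.2
    _ ≤ ∑ _k : Fin d → Fin (2 * (2 * d * s.card) + 1),
          ENNReal.ofReal (Real.exp (-(s.card * κ / 64))) :=
        Finset.sum_le_sum_of_subset (Finset.filter_subset _ _)
    _ = _ := by
        rw [Finset.sum_const, Finset.card_univ, Fintype.card_fun, Fintype.card_fin,
          Fintype.card_fin, nsmul_eq_mul, ENNReal.ofReal_mul (by positivity)]
        congr 1
        rw [← ENNReal.ofReal_natCast]
        push_cast
        ring_nf

end DataCoverage

/-! ### Comparison principles for the Bellman equation. -/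

section Comparison

variable {S A B : Type*} [MeasurableSpace S] [MeasurableSpace A] [MeasurableSpace B]

theorem MarkovGame.value_eq_expSum (G : MarkovGame S A B) (H : ℕ) (π : Policy S A)
    (ν : Policy S B) (h : ℕ) (x : S) :
    G.value H π ν h x = G.expSum (π.joint ν) G.r (H - h) h x := rfl

theorem MarkovGame.integrable_expSum (G : MarkovGame S A B) (σ : Policy S (A × B))
    {g : ℕ → S × A × B → ℝ} (hg : ∀ h, Measurable (g h)) {M : ℝ} (hM : ∀ h z, |g h z| ≤ M)
    (n h : ℕ) (m : Measure S) [IsProbabilityMeasure m] : Integrable (G.expSum σ g n h) m :=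
  Integrable.of_bound (G.measurable_expSum σ hg n h).aestronglyMeasurable (n * M)
    (ae_of_all _ (G.abs_expSum_le σ hM n h))

theorem MarkovGame.abs_r_le (G : MarkovGame S A B) (h : ℕ) (z : S × A × B) : |G.r h z| ≤ 1 :=
  abs_le.mpr ⟨by linarith [(G.r_mem h z).1], (G.r_mem h z).2⟩

theorem MarkovGame.expSum_add_const_mul (G : MarkovGame S A B) (σ : Policy S (A × B))
    {g g' : ℕ → S × A × B → ℝ} (hg : ∀ h, Measurable (g h)) {M : ℝ} (hM : ∀ h z, |g h z| ≤ M)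
    (hg' : ∀ h, Measurable (g' h)) {M' : ℝ} (hM' : ∀ h z, |g' h z| ≤ M') (c : ℝ) (n h : ℕ)
    (x : S) :
    G.expSum σ (fun h z => g h z + c * g' h z) n h x =
      G.expSum σ g n h x + c * G.expSum σ g' n h x := by
  have hint : ∀ {g : ℕ → S × A × B → ℝ} (_ : ∀ h, Measurable (g h)) {M : ℝ}
      (_ : ∀ h z, |g h z| ≤ M), Integrable (fun ω : Fin n → Transition S A B =>
        ∑ j : Fin n, g (h + j) (ω j).1) (G.traj σ n h x) := fun {g} hg {M} hM =>
    integrable_finsetSum _ fun j _ => Integrable.of_bound ((hg _).comp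
      (measurable_fst.comp (measurable_pi_apply j))).aestronglyMeasurable M
      (ae_of_all _ fun ω => hM _ _)
  simp only [MarkovGame.expSum, Finset.sum_add_distrib, ← Finset.mul_sum]
  rw [integral_add (hint hg hM) ((hint hg' hM').const_mul c), integral_const_mul]

variable [Fintype A] [MeasurableSingletonClass A] [Fintype B] [MeasurableSingletonClass B] {H : ℕ}

theorem MarkovGame.expSum_eq_payoff (G : MarkovGame S A B) (π : Policy S A) (ν : Policy S B)
    {g : ℕ → S × A × B → ℝ} (hg : ∀ h, Measurable (g h)) {M : ℝ} (hM : ∀ h z, |g h z| ≤ M)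
    {h : ℕ} (hh : h < H) (x : S) :
    G.expSum (π.joint ν) g (H - h) h x =
      payoff (fun a b => g h (x, a, b) +
        ∫ y, G.expSum (π.joint ν) g (H - (h + 1)) (h + 1) y ∂(G.P h (x, a, b)))
        (π.prob h x) (ν.prob h x) := by
  rw [show H - h = H - (h + 1) + 1 by omega, G.expSum_succ _ hg hM, Policy.integral_joint]

/-- Backward induction: a subsolution of the Bellman equation lies below its solution. -/
theorem MarkovGame.le_expSum_of_le_payoff (G : MarkovGame S A B) (π : Policy S A)
    (ν : Policy S B) {g : ℕ → S × A × B → ℝ} (hg : ∀ h, Measurable (g h)) {M : ℝ}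
    (hM : ∀ h z, |g h z| ≤ M) {W : ℕ → S → ℝ}
    (hWi : ∀ h < H, ∀ z, Integrable (W (h + 1)) (G.P h z)) (hWH : ∀ x, W H x = 0)
    (hW : ∀ h < H, ∀ x, W h x ≤ payoff (fun a b => g h (x, a, b) +
      ∫ y, W (h + 1) y ∂(G.P h (x, a, b))) (π.prob h x) (ν.prob h x))
    {h : ℕ} (hh : h ≤ H) (x : S) : W h x ≤ G.expSum (π.joint ν) g (H - h) h x := by
  induction hh using Nat.decreasingInduction generalizing x with
  | self => rw [hWH, Nat.sub_self, G.expSum_zero]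
  | of_succ h hh ih =>
    rw [G.expSum_eq_payoff π ν hg hM hh]
    refine (hW h hh x).trans (payoff_mono (π.prob_mem_stdSimplex h x) (ν.prob_mem_stdSimplex h x)
      fun a b => add_le_add le_rfl ?_)
    exact integral_mono (hWi h hh _) (G.integrable_expSum _ hg hM _ _ _) ih

/-- Backward induction: a supersolution of the Bellman equation lies above its solution. -/
theorem MarkovGame.expSum_le_of_payoff_le (G : MarkovGame S A B) (π : Policy S A)
    (ν : Policy S B) {g : ℕ → S × A × B → ℝ} (hg : ∀ h, Measurable (g h)) {M : ℝ}
    (hM : ∀ h z, |g h z| ≤ M) {W : ℕ → S → ℝ}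
    (hWi : ∀ h < H, ∀ z, Integrable (W (h + 1)) (G.P h z)) (hWH : ∀ x, W H x = 0)
    (hW : ∀ h < H, ∀ x, payoff (fun a b => g h (x, a, b) +
      ∫ y, W (h + 1) y ∂(G.P h (x, a, b))) (π.prob h x) (ν.prob h x) ≤ W h x)
    {h : ℕ} (hh : h ≤ H) (x : S) : G.expSum (π.joint ν) g (H - h) h x ≤ W h x := by
  induction hh using Nat.decreasingInduction generalizing x with
  | self => rw [hWH, Nat.sub_self, G.expSum_zero]
  | of_succ h hh ih =>
    rw [G.expSum_eq_payoff π ν hg hM hh]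
    refine le_trans (payoff_mono (π.prob_mem_stdSimplex h x) (ν.prob_mem_stdSimplex h x)
      fun a b => add_le_add le_rfl ?_) (hW h hh x)
    exact integral_mono (G.integrable_expSum _ hg hM _ _ _) (hWi h hh _) ih

end Comparison

/-! ### Accuracy of the regression, optimism and pessimism. -/

section Optimism

open Matrix hiding gram

variable {S A B : Type*} [MeasurableSpace S] [MeasurableSpace A] [MeasurableSpace B]
  {H K d : ℕ}

/-- The ridge regression of step `h` approximates the Bellman backup of `V` up to the bonus. -/
def IsAccurate (G : MarkovGame S A B) (φ : S × A × B → EuclideanSpace ℝ (Fin d))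
    (fold : Fin K → Fin H) (β : ℝ) (D : Fin K → Fin H → Sample S A B) (h : Fin H)
    (V : S → ℝ) : Prop :=
  ∀ z, |(φ z).ofLp ⬝ᵥ ridge φ fold 1 D h V - (G.r h z + ∫ y, V y ∂(G.P h z))| ≤
    bonus φ fold 1 β D h z

theorem MarkovGame.IsLinear.isAccurate {G : MarkovGame S A B}
    {φ : S × A × B → EuclideanSpace ℝ (Fin d)} (hG : G.IsLinear H φ) (fold : Fin K → Fin H)
    {β : ℝ} (h : Fin H) {V : S → ℝ} (hVm : Measurable V)
    (hV : ∀ x, V x ∈ Set.Icc (0 : ℝ) ((H : ℝ) - (h + 1 : ℕ)))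
    (ω : Fin K → Fin H → Transition S A B) {t : ℝ}
    (hnoise : matNorm (gram φ fold 1 (G.observe ω) h)⁻¹
      (∑ τ with fold τ = h, (V (ω τ h).2 - ∫ y, V y ∂(G.P h (ω τ h).1)) • φ (ω τ h).1) ≤ √d * t)
    (hβ : √d * t + √d * H ≤ β) : IsAccurate G φ fold β (G.observe ω) h V := by
  intro z
  obtain ⟨μ, hμP, hμ⟩ := hG.transition h h.2
  obtain ⟨θ, hθr, hθ⟩ := hG.reward h h.2
  have hcast : (H : ℝ) - (h + 1 : ℕ) = ((H - (h + 1) : ℕ) : ℝ) := by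
    rw [Nat.cast_sub (by omega)]
  rw [hcast] at hV
  obtain ⟨w, hw, hwP⟩ := exists_weight_of_linear (G.P h) φ μ hμP hμ hVm hV
  have hin : ∀ z, inner ℝ (φ z) (θ + w) = (φ z).ofLp ⬝ᵥ (θ + w).ofLp := fun z => by
    rw [← WithLp.toLp_ofLp 2 (φ z), ← WithLp.toLp_ofLp 2 (θ + w),
      EuclideanSpace.inner_toLp_toLp, star_trivial, dotProduct_comm]
  have hback : ∀ z, G.r h z + ∫ y, V y ∂(G.P h z) = (φ z).ofLp ⬝ᵥ (θ + w).ofLp := fun z => by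
    rw [hθr, hwP, ← inner_add_right, hin]
  -- The reward contributes `√d` and the next value, bounded by `H - (h + 1)`, contributes `√d (H -
  -- (h + 1))`.
  have hnorm : ‖θ + w‖ ≤ √d * H := by
    refine (norm_add_le _ _).trans ((add_le_add hθ hw).trans ?_)
    rw [← hcast]
    push_cast
    nlinarith [Real.sqrt_nonneg (d : ℝ), mul_nonneg (Real.sqrt_nonneg (d : ℝ))
      (Nat.cast_nonneg (h : ℕ) : (0 : ℝ) ≤ (h : ℕ))]
  rw [hback z, ridge, bonus, mul_comm β]
  rw [gram_eq_regGram] at hnoise ⊢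
  refine (abs_ridge_error_le _ _ (fun τ => G.r h (ω τ h).1 + V (ω τ h).2)
    (fun τ => V (ω τ h).2 - ∫ y, V y ∂(G.P h (ω τ h).1)) (θ + w) (φ z) fun τ _ => ?_).trans ?_
  · rw [← hback]
    simp only [MarkovGame.observe]
    ring
  · refine mul_le_mul_of_nonneg_left ?_ (matNorm_nonneg _ _)
    exact (add_le_add hnoise hnorm).trans hβ

variable {G : MarkovGame S A B} {φ : S × A × B → EuclideanSpace ℝ (Fin d)}
  {fold : Fin K → Fin H} {β : ℝ} {D : Fin K → Fin H → Sample S A B} {h : Fin H} {V : S → ℝ}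

theorem MarkovGame.backup_mem_Icc (G : MarkovGame S A B)
    (hV : ∀ x, V x ∈ Set.Icc (0 : ℝ) ((H : ℝ) - (h + 1 : ℕ))) (z : S × A × B) :
    G.r h z + ∫ y, V y ∂(G.P h z) ∈ Set.Icc (0 : ℝ) ((H : ℝ) - h) := by
  have h1 := G.r_mem h z
  have h2 : 0 ≤ ∫ y, V y ∂(G.P h z) := integral_nonneg fun x => (hV x).1
  have h3 : ‖∫ y, V y ∂(G.P h z)‖ ≤ ((H : ℝ) - (h + 1 : ℕ)) * (G.P h z).real Set.univ :=
    norm_integral_le_of_norm_le_const (ae_of_all _ fun x => by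
      rw [Real.norm_of_nonneg (hV x).1]; exact (hV x).2)
  rw [probReal_univ, mul_one, Real.norm_of_nonneg h2] at h3
  push_cast at h3
  exact ⟨add_nonneg h1.1 h2, by linarith [h1.2]⟩

/-- Clipping is harmless because the backup itself lies in `[0, H - h]`. The upper end is written as
a backup with reward `r + 2 bonus`, ready for the comparison principles. -/
theorem IsAccurate.upperQ_mem_Icc (hacc : IsAccurate G φ fold β D h V)
    (hV : ∀ x, V x ∈ Set.Icc (0 : ℝ) ((H : ℝ) - (h + 1 : ℕ))) (z : S × A × B) :
    upperQ φ fold 1 β D h V z ∈ Set.Icc (G.r h z + ∫ y, V y ∂(G.P h z))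
      (G.r h z + 2 * bonus φ fold 1 β D h z + ∫ y, V y ∂(G.P h z)) := by
  have h1 := abs_le.mp (hacc z)
  have h2 := G.backup_mem_Icc hV z
  have h3 : 0 ≤ bonus φ fold 1 β D h z := (abs_nonneg _).trans (hacc z)
  constructor
  · exact le_max_of_le_right (le_min (by linarith) h2.2)
  · exact max_le (by linarith [h2.1]) ((min_le_left _ _).trans (by linarith))

theorem IsAccurate.lowerQ_mem_Icc (hacc : IsAccurate G φ fold β D h V)
    (hV : ∀ x, V x ∈ Set.Icc (0 : ℝ) ((H : ℝ) - (h + 1 : ℕ))) (z : S × A × B) :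
    lowerQ φ fold 1 β D h V z ∈ Set.Icc
      (G.r h z + -2 * bonus φ fold 1 β D h z + ∫ y, V y ∂(G.P h z))
      (G.r h z + ∫ y, V y ∂(G.P h z)) := by
  have h1 := abs_le.mp (hacc z)
  have h2 := G.backup_mem_Icc hV z
  have h3 : 0 ≤ bonus φ fold 1 β D h z := (abs_nonneg _).trans (hacc z)
  constructor
  · exact le_max_of_le_right (le_min (by linarith) (by linarith [h2.2]))
  · exact max_le h2.1 ((min_le_left _ _).trans (by linarith))

end Optimism

/-! ### Bounds on the bonuses. -/

section Bonuses

open Matrix hiding gram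

variable {S A B : Type*} {H K d : ℕ}

/-- The bonuses of all steps, extended by `0` past the horizon. -/
def bonusSeq (φ : S × A × B → EuclideanSpace ℝ (Fin d)) (fold : Fin K → Fin H) (β : ℝ)
    (D : Fin K → Fin H → Sample S A B) (h : ℕ) (z : S × A × B) : ℝ :=
  if hh : h < H then bonus φ fold 1 β D ⟨h, hh⟩ z else 0

variable {φ : S × A × B → EuclideanSpace ℝ (Fin d)} {fold : Fin K → Fin H} {β : ℝ}
  {D : Fin K → Fin H → Sample S A B}

theorem bonusSeq_val (h : Fin H) (z : S × A × B) :
    bonusSeq φ fold β D h z = bonus φ fold 1 β D h z := by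
  simp [bonusSeq]

theorem matNorm_gram_inv_le_one (hφ1 : ∀ z, ‖φ z‖ ≤ 1) (h : Fin H) (z : S × A × B) :
    matNorm (gram φ fold 1 D h)⁻¹ (φ z) ≤ 1 := by
  rw [gram_eq_regGram]
  exact (matNorm_regGram_inv_le _ _ _).trans (hφ1 z)

theorem matNorm_gram_inv_le_of_le {φ : S × A × B → EuclideanSpace ℝ (Fin d)}
    (hφ1 : ∀ z, ‖φ z‖ ≤ 1) {fold : Fin K → Fin H} {D : Fin K → Fin H → Sample S A B} {h : Fin H}
    {α : ℝ} (hα : 0 < α) (hL : ∀ v : Fin d → ℝ, α * (v ⬝ᵥ v) ≤ v ⬝ᵥ gram φ fold 1 D h *ᵥ v)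
    (z : S × A × B) : matNorm (gram φ fold 1 D h)⁻¹ (φ z) ≤ 1 / √α := by
  have hpos : (gram φ fold 1 D h).PosDef := by
    rw [gram_eq_regGram]; exact posDef_regGram _ _
  refine (matNorm_inv_le hpos hα hL (φ z)).trans ?_
  gcongr
  exact hφ1 z

theorem abs_bonusSeq_le (hβ : 0 ≤ β) {M : ℝ} (hM0 : 0 ≤ M)
    (hM : ∀ h z, matNorm (gram φ fold 1 D h)⁻¹ (φ z) ≤ M) (h : ℕ) (z : S × A × B) :
    |bonusSeq φ fold β D h z| ≤ β * M := by
  by_cases hh : h < H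
  · simp only [bonusSeq, hh, dif_pos, bonus]
    rw [abs_of_nonneg (mul_nonneg hβ (matNorm_nonneg _ _))]
    exact mul_le_mul_of_nonneg_left (hM _ _) hβ
  · simp only [bonusSeq, hh, dif_neg, not_false_eq_true, abs_zero]
    positivity

end Bonuses

/-! ### Sandwiching the game values between the estimates. -/

section Sandwich

open Matrix hiding gram

variable {S A B : Type*} [MeasurableSpace S] [MeasurableSpace A] [MeasurableSpace B]
  {H K d : ℕ}

variable {G : MarkovGame S A B} {φ : S × A × B → EuclideanSpace ℝ (Fin d)}
  {fold : Fin K → Fin H} {β : ℝ} {D : Fin K → Fin H → Sample S A B}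

theorem measurable_matNorm_gram_inv (hφ : Measurable φ) (h : Fin H) :
    Measurable fun z => matNorm (gram φ fold 1 D h)⁻¹ (φ z) := by
  rw [gram_eq_regGram]
  exact measurable_matNorm_regGram_inv _
    (f := fun τ (_ : S × A × B) => φ (D τ h).sa) (fun _ => measurable_const) hφ

theorem measurable_bonusSeq (hφ : Measurable φ) (h : ℕ) :
    Measurable (bonusSeq φ fold β D h) := by
  by_cases hh : h < H
  · have : bonusSeq φ fold β D h = fun z => bonus φ fold 1 β D ⟨h, hh⟩ z := by
      funext z; simp [bonusSeq, hh]
    rw [this]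
    exact measurable_const.mul (measurable_matNorm_gram_inv hφ _)
  · have : bonusSeq φ fold β D h = fun _ => 0 := by
      funext z; simp [bonusSeq, hh]
    rw [this]
    exact measurable_const

theorem MarkovGame.expSum_bonusSeq (G : MarkovGame S A B) (hφ : Measurable φ)
    (hφ1 : ∀ z, ‖φ z‖ ≤ 1) (π : Policy S A) (ν : Policy S B) (x : S) :
    G.expSum (π.joint ν) (bonusSeq φ fold β D) H 0 x =
      β * G.uncertainty φ (gram φ fold 1 D) π ν x := by
  have h1 : ∀ (ω : Fin H → Transition S A B) (j : Fin H),
      bonusSeq φ fold β D (0 + j) (ω j).1 =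
        β * matNorm (gram φ fold 1 D j)⁻¹ (φ (ω j).1) := fun ω j => by
    rw [zero_add, bonusSeq_val, bonus]
  simp only [MarkovGame.expSum, h1, MarkovGame.uncertainty, ← Finset.mul_sum]
  rw [integral_const_mul, integral_finsetSum]
  intro j _
  refine Integrable.of_bound ((measurable_matNorm_gram_inv hφ j).comp
    (measurable_fst.comp (measurable_pi_apply j))).aestronglyMeasurable 1 (ae_of_all _ fun ω => ?_)
  rw [Real.norm_of_nonneg (matNorm_nonneg _ _)]
  exact matNorm_gram_inv_le_one hφ1 _ _

/-- This crude bound makes the suprema over policies genuine; an unbounded real supremum would take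
the default value `0`. -/
theorem MarkovGame.uncertainty_le (G : MarkovGame S A B) (hφ1 : ∀ z, ‖φ z‖ ≤ 1)
    (π : Policy S A) (ν : Policy S B) (x : S) :
    G.uncertainty φ (gram φ fold 1 D) π ν x ≤ H := by
  calc _ ≤ ∑ _h : Fin H, (1 : ℝ) := Finset.sum_le_sum fun h _ => by
        refine (le_abs_self _).trans ((norm_integral_le_of_norm_le_const
          (μ := G.traj (π.joint ν) H 0 x) (C := 1)
          (f := fun ω => matNorm (gram φ fold 1 D h)⁻¹ (φ (ω h).1)) (ae_of_all _ fun ω => ?_)).trans ?_)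
        · rw [Real.norm_of_nonneg (matNorm_nonneg _ _)]
          exact matNorm_gram_inv_le_one hφ1 _ _
        · simp
    _ = H := by simp

variable [Fintype A] [Fintype B] {R : SPMVIRun S A B}

/-- The hypotheses under which the estimates of a run sandwich the values of the game. -/
structure SPMVIRun.IsGood (R : SPMVIRun S A B) (G : MarkovGame S A B)
    (φ : S × A × B → EuclideanSpace ℝ (Fin d)) (fold : Fin K → Fin H) (β : ℝ)
    (D : Fin K → Fin H → Sample S A B) : Prop where
  isRunOn : R.IsRunOn φ fold 1 β D
  measurable_loV : ∀ h ≤ H, Measurable (R.loV h)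
  measurable_upV : ∀ h ≤ H, Measurable (R.upV h)
  accurate_loV : ∀ h : Fin H, IsAccurate G φ fold β D h (R.loV (h + 1))
  accurate_upV : ∀ h : Fin H, IsAccurate G φ fold β D h (R.upV (h + 1))

theorem SPMVIRun.IsGood.integrable_upV (hR : R.IsGood G φ fold β D) {h : ℕ} (hh : h < H)
    (z : S × A × B) : Integrable (R.upV (h + 1)) (G.P h z) :=
  Integrable.of_mem_Icc _ _ (hR.measurable_upV _ hh).aemeasurable
    (ae_of_all _ fun x => hR.isRunOn.isValueEstimate_upV.mem_Icc hh x)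

theorem SPMVIRun.IsGood.integrable_loV (hR : R.IsGood G φ fold β D) {h : ℕ} (hh : h < H)
    (z : S × A × B) : Integrable (R.loV (h + 1)) (G.P h z) :=
  Integrable.of_mem_Icc _ _ (hR.measurable_loV _ hh).aemeasurable
    (ae_of_all _ fun x => hR.isRunOn.isValueEstimate_loV.mem_Icc hh x)

/-- The trivial bound, for the case in which the folds are too small for coverage. -/
theorem SPMVIRun.IsGood.abs_value_sub_le_horizon (hR : R.IsGood G φ fold β D)
    {πStar : Policy S A} {νStar : Policy S B}
    {h : ℕ} (hh : h < H) (x : S) :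
    |G.value H πStar νStar h x - R.upV h x| ≤ H ∧
      |G.value H πStar νStar h x - R.loV h x| ≤ H := by
  have h1 := hR.isRunOn.isValueEstimate_upV.mem_Icc hh.le x
  have h2 := hR.isRunOn.isValueEstimate_loV.mem_Icc hh.le x
  have h3 : 0 ≤ G.value H πStar νStar h x :=
    G.expSum_nonneg _ (fun h z => (G.r_mem h z).1) _ _ _
  have h4 : G.value H πStar νStar h x ≤ H := by
    refine (le_abs_self _).trans ((G.abs_expSum_le _ G.abs_r_le _ _ x).trans ?_)
    rw [mul_one]
    exact_mod_cast Nat.sub_le _ _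
  have h5 : (0 : ℝ) ≤ h := Nat.cast_nonneg h
  constructor <;> rw [abs_le] <;> constructor <;> linarith [h1.1, h1.2, h2.1, h2.2]

variable [MeasurableSingletonClass A] [MeasurableSingletonClass B]

/-- `νHat` is a minimizing equilibrium strategy, so no `π` gets more than the equilibrium value
against it; as `upperQ` dominates the backup, `upV` is a supersolution for `(π, νHat)`. -/
theorem SPMVIRun.IsGood.value_le_upV (hR : R.IsGood G φ fold β D) (π : Policy S A) {h : ℕ}
    (hh : h ≤ H) (x : S) : G.value H π R.νHat h x ≤ R.upV h x := by
  rw [G.value_eq_expSum]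
  refine G.expSum_le_of_payoff_le π R.νHat G.measurable_r G.abs_r_le
    (fun h hh z => hR.integrable_upV hh z) hR.isRunOn.upV_last (fun h hh x => ?_) hh x
  rw [show R.upV h x = _ from hR.isRunOn.upV_eq ⟨h, hh⟩ x]
  obtain ⟨-, hq, h1, -⟩ := hR.isRunOn.upper_nash ⟨h, hh⟩ x
  refine le_trans ?_ (h1 _ (π.prob_mem_stdSimplex h x))
  exact payoff_mono (π.prob_mem_stdSimplex h x) hq fun a b =>
    ((hR.accurate_upV ⟨h, hh⟩).upperQ_mem_Icc
      (hR.isRunOn.isValueEstimate_upV.mem_Icc (h := h + 1) hh) _).1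

theorem SPMVIRun.IsGood.loV_le_value (hR : R.IsGood G φ fold β D) (ν : Policy S B) {h : ℕ}
    (hh : h ≤ H) (x : S) : R.loV h x ≤ G.value H R.πHat ν h x := by
  rw [G.value_eq_expSum]
  refine G.le_expSum_of_le_payoff R.πHat ν G.measurable_r G.abs_r_le
    (fun h hh z => hR.integrable_loV hh z) hR.isRunOn.loV_last (fun h hh x => ?_) hh x
  rw [show R.loV h x = _ from hR.isRunOn.loV_eq ⟨h, hh⟩ x]
  obtain ⟨hp, -, -, h1⟩ := hR.isRunOn.lower_nash ⟨h, hh⟩ x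
  refine (h1 _ (ν.prob_mem_stdSimplex h x)).trans ?_
  exact payoff_mono hp (ν.prob_mem_stdSimplex h x) fun a b =>
    ((hR.accurate_loV ⟨h, hh⟩).lowerQ_mem_Icc
      (hR.isRunOn.isValueEstimate_loV.mem_Icc (h := h + 1) hh) _).2

/-- `πAux` secures the equilibrium value of `upperQ` against every `ν`, so `upV` is a subsolution
for `(πAux, ν)` with rewards raised by two bonuses. -/
theorem SPMVIRun.IsGood.upV_le (hR : R.IsGood G φ fold β D) (hφ : Measurable φ)
    (hφ1 : ∀ z, ‖φ z‖ ≤ 1) (hβ : 0 ≤ β) (ν : Policy S B) {h : ℕ} (hh : h ≤ H) (x : S) :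
    R.upV h x ≤ G.value H R.πAux ν h x +
      2 * G.expSum (R.πAux.joint ν) (bonusSeq φ fold β D) (H - h) h x := by
  have hb := abs_bonusSeq_le (D := D) (fold := fold) hβ zero_le_one
    (fun h z => matNorm_gram_inv_le_one hφ1 h z)
  rw [G.value_eq_expSum, ← G.expSum_add_const_mul _ G.measurable_r G.abs_r_le
    (measurable_bonusSeq hφ) hb]
  refine G.le_expSum_of_le_payoff R.πAux ν
    (g := fun h z => G.r h z + 2 * bonusSeq φ fold β D h z) (M := 1 + 2 * (β * 1))
    (fun h => (G.measurable_r h).add (measurable_const.mul (measurable_bonusSeq hφ h)))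
    (fun h z => ?_) (fun h hh z => hR.integrable_upV hh z) hR.isRunOn.upV_last
    (fun h hh x => ?_) hh x
  · refine (abs_add_le _ _).trans (add_le_add (G.abs_r_le h z) ?_)
    rw [abs_mul, abs_two]
    exact mul_le_mul_of_nonneg_left (hb h z) zero_le_two
  · rw [show R.upV h x = _ from hR.isRunOn.upV_eq ⟨h, hh⟩ x]
    obtain ⟨hp, -, -, h1⟩ := hR.isRunOn.upper_nash ⟨h, hh⟩ x
    refine (h1 _ (ν.prob_mem_stdSimplex h x)).trans ?_
    refine payoff_mono hp (ν.prob_mem_stdSimplex h x) fun a b => ?_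
    rw [show bonusSeq φ fold β D h (x, a, b) = _ from bonusSeq_val ⟨h, hh⟩ _]
    exact ((hR.accurate_upV ⟨h, hh⟩).upperQ_mem_Icc
      (hR.isRunOn.isValueEstimate_upV.mem_Icc (h := h + 1) hh) _).2

theorem SPMVIRun.IsGood.le_loV (hR : R.IsGood G φ fold β D) (hφ : Measurable φ)
    (hφ1 : ∀ z, ‖φ z‖ ≤ 1) (hβ : 0 ≤ β) (π : Policy S A) {h : ℕ} (hh : h ≤ H) (x : S) :
    G.value H π R.νAux h x +
      -2 * G.expSum (π.joint R.νAux) (bonusSeq φ fold β D) (H - h) h x ≤ R.loV h x := by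
  have hb := abs_bonusSeq_le (D := D) (fold := fold) hβ zero_le_one
    (fun h z => matNorm_gram_inv_le_one hφ1 h z)
  rw [G.value_eq_expSum, ← G.expSum_add_const_mul _ G.measurable_r G.abs_r_le
    (measurable_bonusSeq hφ) hb]
  refine G.expSum_le_of_payoff_le π R.νAux
    (g := fun h z => G.r h z + -2 * bonusSeq φ fold β D h z) (M := 1 + 2 * (β * 1))
    (fun h => (G.measurable_r h).add (measurable_const.mul (measurable_bonusSeq hφ h)))
    (fun h z => ?_) (fun h hh z => hR.integrable_loV hh z) hR.isRunOn.loV_last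
    (fun h hh x => ?_) hh x
  · refine (abs_add_le _ _).trans (add_le_add (G.abs_r_le h z) ?_)
    rw [abs_mul, abs_neg, abs_two]
    exact mul_le_mul_of_nonneg_left (hb h z) zero_le_two
  · rw [show R.loV h x = _ from hR.isRunOn.loV_eq ⟨h, hh⟩ x]
    obtain ⟨-, hq, h1, -⟩ := hR.isRunOn.lower_nash ⟨h, hh⟩ x
    refine le_trans ?_ (h1 _ (π.prob_mem_stdSimplex h x))
    refine payoff_mono (π.prob_mem_stdSimplex h x) hq fun a b => ?_
    rw [show bonusSeq φ fold β D h (x, a, b) = _ from bonusSeq_val ⟨h, hh⟩ _]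
    exact ((hR.accurate_loV ⟨h, hh⟩).lowerQ_mem_Icc
      (hR.isRunOn.isValueEstimate_loV.mem_Icc (h := h + 1) hh) _).1

variable {πStar : Policy S A} {νStar : Policy S B}

/-- The duality gap of the output is bounded by the uncertainty along the best responses to the
Nash equilibrium. -/
theorem SPMVIRun.IsGood.gap_le (hR : R.IsGood G φ fold β D) (hφ : Measurable φ)
    (hφ1 : ∀ z, ‖φ z‖ ≤ 1) (hβ : 0 ≤ β) (hH : 0 < H) (hN : G.IsNash H πStar νStar) (x : S) :
    G.gap H R.πHat R.νHat x ≤ 2 * β *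
      ((⨆ ν : Policy S B, G.uncertainty φ (gram φ fold 1 D) πStar ν x) +
        (⨆ π : Policy S A, G.uncertainty φ (gram φ fold 1 D) π νStar x)) := by
  have : Nonempty (Policy S A) := ⟨πStar⟩
  have : Nonempty (Policy S B) := ⟨νStar⟩
  have h1 : (⨆ π' : Policy S A, G.value H π' R.νHat 0 x) ≤ R.upV 0 x :=
    ciSup_le fun π => hR.value_le_upV π (Nat.zero_le _) x
  have h2 : R.loV 0 x ≤ ⨅ ν' : Policy S B, G.value H R.πHat ν' 0 x :=
    le_ciInf fun ν => hR.loV_le_value ν (Nat.zero_le _) x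
  have h3 := hR.upV_le hφ hφ1 hβ νStar (Nat.zero_le _) x
  have h4 := hR.le_loV hφ hφ1 hβ πStar (Nat.zero_le _) x
  rw [Nat.sub_zero, G.expSum_bonusSeq hφ hφ1] at h3 h4
  -- The equilibrium value separates the values of `(πAux, νStar)` and `(πStar, νAux)`, so their
  -- difference is nonpositive.
  have h5 := (hN 0 hH x).1 R.πAux
  have h6 := (hN 0 hH x).2 R.νAux
  have h7 : G.uncertainty φ (gram φ fold 1 D) πStar R.νAux x ≤
      ⨆ ν : Policy S B, G.uncertainty φ (gram φ fold 1 D) πStar ν x :=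
    le_ciSup (f := fun ν : Policy S B => G.uncertainty φ (gram φ fold 1 D) πStar ν x)
      ⟨H, by rintro _ ⟨ν, rfl⟩; exact G.uncertainty_le hφ1 _ _ x⟩ R.νAux
  have h8 : G.uncertainty φ (gram φ fold 1 D) R.πAux νStar x ≤
      ⨆ π : Policy S A, G.uncertainty φ (gram φ fold 1 D) π νStar x :=
    le_ciSup (f := fun π : Policy S A => G.uncertainty φ (gram φ fold 1 D) π νStar x)
      ⟨H, by rintro _ ⟨π, rfl⟩; exact G.uncertainty_le hφ1 _ _ x⟩ R.πAux
  have h9 := mul_le_mul_of_nonneg_left (add_le_add h7 h8) (mul_nonneg zero_le_two hβ)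
  rw [MarkovGame.gap]
  linarith

/-- The estimates of the value functions are accurate if all the bonuses are small. -/
theorem SPMVIRun.IsGood.abs_value_sub_le (hR : R.IsGood G φ fold β D) (hφ : Measurable φ)
    (hφ1 : ∀ z, ‖φ z‖ ≤ 1) (hβ : 0 ≤ β) (hN : G.IsNash H πStar νStar) {M : ℝ} (hM0 : 0 ≤ M)
    (hM : ∀ h z, matNorm (gram φ fold 1 D h)⁻¹ (φ z) ≤ M) {h : ℕ} (hh : h < H) (x : S) :
    |G.value H πStar νStar h x - R.upV h x| ≤ 2 * (H * (β * M)) ∧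
      |G.value H πStar νStar h x - R.loV h x| ≤ 2 * (H * (β * M)) := by
  have hE : ∀ σ : Policy S (A × B),
      G.expSum σ (bonusSeq φ fold β D) (H - h) h x ≤ H * (β * M) := fun σ => by
    refine (le_abs_self _).trans ((G.abs_expSum_le σ (abs_bonusSeq_le hβ hM0 hM) _ _ x).trans ?_)
    gcongr
    exact Nat.sub_le _ _
  have hpos : 0 ≤ H * (β * M) := by positivity
  have h1 := hR.upV_le hφ hφ1 hβ νStar hh.le x
  have h2 := hR.le_loV hφ hφ1 hβ πStar hh.le x
  have h3 := hR.value_le_upV πStar hh.le x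
  have h4 := hR.loV_le_value νStar hh.le x
  have h5 := hN h hh x
  have h6 := hE (R.πAux.joint νStar)
  have h7 := hE (πStar.joint R.νAux)
  constructor <;> rw [abs_le] <;> constructor <;>
    linarith [h5.1 R.πAux, h5.2 R.νAux, h5.1 R.πHat, h5.2 R.νHat]

end Sandwich

/-! ### Numerical estimates for the failure probabilities and the rate. -/

section Constants

variable {d H K n : ℕ} {δ : ℝ}

theorem exp_logFactor (hd : 1 ≤ d) (hH : 1 ≤ H) (hK : 1 ≤ K) (hδ : 0 < δ) :
    Real.exp (logFactor d H K δ) = 2 * d * H * K / δ := by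
  rw [logFactor, Real.exp_log]
  positivity

theorem two_mul_le_exp_logFactor (hd : 1 ≤ d) (hH : 1 ≤ H) (hK : 1 ≤ K) (hδ : 0 < δ)
    (hδ1 : δ < 1) : 2 * (d * H * K : ℝ) ≤ Real.exp (logFactor d H K δ) := by
  rw [exp_logFactor hd hH hK hδ, le_div_iff₀ hδ]
  have : (0 : ℝ) ≤ 2 * d * H * K := by positivity
  nlinarith

theorem one_le_prod (hd : 1 ≤ d) (hH : 1 ≤ H) (hK : 1 ≤ K) : (1 : ℝ) ≤ d * H * K := by
  exact_mod_cast Nat.mul_pos (Nat.mul_pos hd hH) hK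

theorem two_le_exp_logFactor (hd : 1 ≤ d) (hH : 1 ≤ H) (hK : 1 ≤ K) (hδ : 0 < δ)
    (hδ1 : δ < 1) : 2 ≤ Real.exp (logFactor d H K δ) := by
  have := two_mul_le_exp_logFactor hd hH hK hδ hδ1
  have := one_le_prod hd hH hK
  linarith

theorem half_le_logFactor (hd : 1 ≤ d) (hH : 1 ≤ H) (hK : 1 ≤ K) (hδ : 0 < δ) (hδ1 : δ < 1) :
    1 / 2 ≤ logFactor d H K δ := by
  have h1 := two_le_exp_logFactor hd hH hK hδ hδ1
  have h2 : Real.log 2 ≤ logFactor d H K δ := by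
    rwa [Real.log_le_iff_le_exp two_pos]
  linarith [Real.log_two_gt_d9]

theorem half_le_sqrt_logFactor (hd : 1 ≤ d) (hH : 1 ≤ H) (hK : 1 ≤ K) (hδ : 0 < δ)
    (hδ1 : δ < 1) : 1 / 2 ≤ √(logFactor d H K δ) := by
  refine Real.le_sqrt_of_sq_le ?_
  linarith [half_le_logFactor hd hH hK hδ hδ1]

/-- The Hoeffding exponent is `8 ι`. One factor `exp (-ι)` pays for `2 d H / δ`, and the other seven
give at most `2⁻⁷`. -/
theorem noise_failure_le (hd : 1 ≤ d) (hH : 1 ≤ H) (hK : 1 ≤ K) (hδ : 0 < δ) (hδ1 : δ < 1) :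
    H * (2 * (d * (2 * Real.exp (-(2 * (2 * H * √(logFactor d H K δ)) ^ 2 / (H : ℝ) ^ 2))))) ≤
      δ / 2 := by
  set ι := logFactor d H K δ with hι
  have hι0 : 0 ≤ ι := by linarith [half_le_logFactor hd hH hK hδ hδ1]
  have hH0 : (0 : ℝ) < H := by exact_mod_cast hH
  have hy2 := two_le_exp_logFactor hd hH hK hδ hδ1
  have hyK : (2 * d * H : ℝ) ≤ Real.exp ι * δ := by
    rw [exp_logFactor hd hH hK hδ, div_mul_cancel₀ _ hδ.ne']
    have hK1 : (1 : ℝ) ≤ K := by exact_mod_cast hK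
    exact le_mul_of_one_le_right (by positivity) hK1
  have e1 : 2 * (2 * H * √ι) ^ 2 / (H : ℝ) ^ 2 = 8 * ι := by
    rw [mul_pow, mul_pow, Real.sq_sqrt hι0]
    field_simp
    ring
  rw [e1, Real.exp_neg, show 8 * ι = ((8 : ℕ) : ℝ) * ι by norm_num, Real.exp_nat_mul]
  set y := Real.exp ι
  have hy0 : 0 < y := Real.exp_pos _
  have h7 : (128 : ℝ) ≤ y ^ 7 := by
    calc (128 : ℝ) = 2 ^ 7 := by norm_num
      _ ≤ y ^ 7 := by gcongr
  calc _ = (2 * d * H : ℝ) * 2 * (y ^ 8)⁻¹ := by ring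
    _ ≤ (y * δ) * 2 * (y ^ 8)⁻¹ := by gcongr
    _ = 2 * δ * (y ^ 7)⁻¹ := by field_simp
    _ ≤ 2 * δ * (128 : ℝ)⁻¹ := by gcongr
    _ ≤ δ / 2 := by linarith

/-- The grid has at most `exp (3 d ι)` points and `H ≤ exp ι * (δ / 2)`, whereas the Chernoff factor
is at most `exp (-4 d ι)`; this explains the threshold `256 = 4 * 64`. -/
theorem coverage_failure_le (hd : 1 ≤ d) (hH : 1 ≤ H) (hK : 1 ≤ K) (hnK : n ≤ K) (hδ : 0 < δ)
    (hδ1 : δ < 1) {κ : ℝ} (hκ : 256 * d * logFactor d H K δ ≤ n * κ) :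
    H * ((4 * d * n + 1) ^ d * Real.exp (-(n * κ / 64))) ≤ δ / 2 := by
  set ι := logFactor d H K δ with hι
  have hι0 : 0 ≤ ι := by linarith [half_le_logFactor hd hH hK hδ hδ1]
  have hd1 : (1 : ℝ) ≤ d := by exact_mod_cast hd
  have hH1 : (1 : ℝ) ≤ H := by exact_mod_cast hH
  have hK1 : (1 : ℝ) ≤ K := by exact_mod_cast hK
  have hn1 : (n : ℝ) ≤ K := by exact_mod_cast hnK
  have hy := two_mul_le_exp_logFactor hd hH hK hδ hδ1
  have hy2 := two_le_exp_logFactor hd hH hK hδ hδ1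
  have hyH : (H : ℝ) ≤ Real.exp ι * (δ / 2) := by
    rw [exp_logFactor hd hH hK hδ]
    have : 2 * d * H * K / δ * (δ / 2) = H * (d * K : ℝ) := by field_simp
    rw [this]
    exact le_mul_of_one_le_right (by positivity) (one_le_mul_of_one_le_of_one_le hd1 hK1)
  have hbase : (4 * d * n + 1 : ℝ) ≤ Real.exp ι ^ 3 := by
    have h1 : (4 * d * n + 1 : ℝ) ≤ 5 * (d * H * K) := by
      have h2 : (d * n : ℝ) ≤ d * H * K := by
        calc (d * n : ℝ) ≤ d * K := by gcongr
          _ ≤ d * H * K := by gcongr; exact le_mul_of_one_le_right (by positivity) hH1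
      linarith [one_le_prod hd hH hK]
    have h3 : Real.exp ι * 4 ≤ Real.exp ι ^ 3 := by
      have : (4 : ℝ) ≤ Real.exp ι ^ 2 := by nlinarith
      calc Real.exp ι * 4 ≤ Real.exp ι * Real.exp ι ^ 2 := by gcongr
        _ = _ := by ring
    linarith
  calc _ ≤ (Real.exp ι * (δ / 2)) * ((Real.exp ι ^ 3) ^ d * Real.exp (-(4 * d * ι))) := by
        gcongr
        linarith
    _ = (δ / 2) * Real.exp (ι - d * ι) := by
        rw [← pow_mul, ← Real.exp_nat_mul]
        calc _ = (δ / 2) * (Real.exp ι * (Real.exp (((3 * d : ℕ) : ℝ) * ι) *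
              Real.exp (-(4 * d * ι)))) := by ring
          _ = _ := by
            rw [← Real.exp_add, ← Real.exp_add]
            push_cast
            ring_nf
    _ ≤ (δ / 2) * 1 := by
        gcongr
        rw [Real.exp_le_one_iff]
        nlinarith
    _ = δ / 2 := mul_one _

/-- The half power in `H ^ (5 / 2)` is the price of splitting: each fold has only `n = K / H`
trajectories. -/
theorem rate_eq (hH : 1 ≤ H) (hnK : H * n = K) (κ : ℝ) :
    (H : ℝ) ^ (5 / 2 : ℝ) * √d / √(K * κ) = (H : ℝ) ^ 2 * √d / √(n * κ) := by
  have hH0 : (0 : ℝ) < H := by exact_mod_cast hH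
  have h1 : (H : ℝ) ^ (5 / 2 : ℝ) = (H : ℝ) ^ 2 * √H := by
    rw [Real.sqrt_eq_rpow, ← Real.rpow_natCast, ← Real.rpow_add hH0]
    norm_num
  have h2 : √(K * κ) = √H * √(n * κ) := by
    rw [← hnK, Nat.cast_mul, mul_assoc, Real.sqrt_mul hH0.le]
  rw [h1, h2]
  have : 0 < √(H : ℝ) := Real.sqrt_pos.mpr hH0
  rw [show (H : ℝ) ^ 2 * √H * √d = √H * ((H : ℝ) ^ 2 * √d) by ring, mul_div_mul_left _ _ this.ne']

theorem bonus_rate_le (hH : 1 ≤ H) (hnK : H * n = K) (hn : 0 < n) {κ c ι : ℝ} (hκ : 0 < κ)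
    (hc : 0 ≤ c) :
    2 * (H * (c * √d * H * √ι * (1 / √(n * κ / 32)))) ≤
      (12 * c + 16) * √ι * ((H : ℝ) ^ (5 / 2 : ℝ) * √d / √(K * κ)) := by
  have hn0 : (0 : ℝ) < n := by exact_mod_cast hn
  rw [rate_eq hH hnK, Real.sqrt_div (by positivity)]
  have hs : 0 < √(n * κ) := Real.sqrt_pos.mpr (by positivity)
  have h32 : √32 ≤ 6 := Real.sqrt_le_iff.mpr ⟨by norm_num, by norm_num⟩
  have hX : 0 ≤ √ι * ((H : ℝ) ^ 2 * √d / √(n * κ)) := by positivity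
  calc _ = (2 * c * √32) * (√ι * ((H : ℝ) ^ 2 * √d / √(n * κ))) := by
        field_simp
    _ ≤ (12 * c + 16) * (√ι * ((H : ℝ) ^ 2 * √d / √(n * κ))) := by
        gcongr
        nlinarith
    _ = _ := by ring

theorem horizon_le_rate (hd : 1 ≤ d) (hH : 1 ≤ H) (hnK : H * n = K) (hn : 0 < n) {κ c ι : ℝ}
    (hκ : 0 < κ) (hc : 0 ≤ c) (hι : 0 < ι) (hlt : n * κ < 256 * d * ι) :
    (H : ℝ) ≤ (12 * c + 16) * √ι * ((H : ℝ) ^ (5 / 2 : ℝ) * √d / √(K * κ)) := by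
  have hn0 : (0 : ℝ) < n := by exact_mod_cast hn
  have hH1 : (1 : ℝ) ≤ H := by exact_mod_cast hH
  rw [rate_eq hH hnK]
  have hs : 0 < √(n * κ) := Real.sqrt_pos.mpr (by positivity)
  have hs2 : √(n * κ) ≤ 16 * √d * √ι := by
    refine Real.sqrt_le_iff.mpr ⟨by positivity, ?_⟩
    rw [mul_pow, mul_pow, Real.sq_sqrt (Nat.cast_nonneg _), Real.sq_sqrt hι.le]
    linarith
  rw [← mul_div_assoc, le_div_iff₀ hs]
  calc H * √(n * κ) ≤ (H : ℝ) ^ 2 * (16 * √d * √ι) := by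
        gcongr
        nlinarith
    _ = 16 * √ι * ((H : ℝ) ^ 2 * √d) := by ring
    _ ≤ _ := by
        gcongr
        linarith

end Constants

/-! ### The good event and the theorem. -/

section Main

open Matrix hiding gram

variable {S A B : Type*} [MeasurableSpace S] [MeasurableSpace A] [MeasurableSpace B]
  {H K d : ℕ}

theorem MarkovGame.IsLinear.one_le_dim {G : MarkovGame S A B}
    {φ : S × A × B → EuclideanSpace ℝ (Fin d)} (hG : G.IsLinear H φ) (hH : 1 ≤ H)
    (z : S × A × B) : 1 ≤ d := by
  by_contra hd
  obtain rfl : d = 0 := by omega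
  obtain ⟨μ, hμ, -⟩ := hG.transition 0 hH
  have h1 := hμ z Set.univ MeasurableSet.univ
  rw [probReal_univ, Subsingleton.elim (φ z) 0, inner_zero_left] at h1
  exact one_ne_zero h1

variable [Fintype A] [MeasurableSingletonClass A] [Fintype B] [MeasurableSingletonClass B]

/-- With high probability, every run of the algorithm is good. -/
theorem MarkovGame.exists_good_event [Nonempty A] [Nonempty B] {G : MarkovGame S A B}
    {φ : S × A × B → EuclideanSpace ℝ (Fin d)} (hG : G.IsLinear H φ) (ρ : Measure S)
    [IsProbabilityMeasure ρ] (b : Policy S (A × B)) (fold : Fin K → Fin H) {β t : ℝ} (ht : 0 ≤ t)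
    (hβ : √d * t + √d * H ≤ β) :
    ∃ N : Set (Fin K → Fin H → Transition S A B),
      G.dataLaw ρ b H K N ≤
        ENNReal.ofReal (H * (2 * (d * (2 * Real.exp (-(2 * t ^ 2 / (H : ℝ) ^ 2)))))) ∧
      ∀ ω ∉ N, ∀ R : SPMVIRun S A B, R.IsRunOn φ fold 1 β (G.observe ω) →
        R.IsGood G φ fold β (G.observe ω) := by
  have hest : ∀ (β : ℝ) (h : Fin (H + 1)), ∃ V : (Fin K → Fin H → Transition S A B) → S → ℝ,
      Measurable (Function.uncurry V) ∧
      (∀ ω ω', (∀ τ, (h : ℕ) ≤ fold τ → ω τ = ω' τ) → V ω = V ω') ∧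
      (∀ ω x, V ω x ∈ Set.Icc (0 : ℝ) H) ∧
      ∀ ω W, IsValueEstimate φ fold β (G.observe ω) W → W h = V ω := fun β h =>
    exists_measurable_estimate G hG.measurable fold β (Nat.lt_succ_iff.mp h.2)
  choose V hVm hVdep hV hVeq using hest
  set N : ℝ → Fin H → Set (Fin K → Fin H → Transition S A B) := fun β h =>
    {ω | √d * t < matNorm (gram φ fold 1 (G.observe ω) h)⁻¹
        (∑ τ with fold τ = h, (V β h.succ ω (ω τ h).2 - ∫ y, V β h.succ ω y ∂(G.P h (ω τ h).1)) •
          φ (ω τ h).1)} with hN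
  have hNle : ∀ β h, G.dataLaw ρ b H K (N β h) ≤
      ENNReal.ofReal (d * (2 * Real.exp (-(2 * t ^ 2 / (H : ℝ) ^ 2)))) := fun β h =>
    G.measure_noise_le ρ b hG.measurable fold h (hVm β h.succ)
      -- The regression of step `h` uses the estimate of step `h + 1`, which depends only on folds
      -- strictly after `h`; this is where the splitting enters.
      (fun ω ω' hω => hVdep β h.succ ω ω' fun τ hτ => hω τ fun e => by
        rw [e, Fin.val_succ] at hτ; omega) (hV β h.succ) ht
  refine ⟨⋃ h, (N (-β) h ∪ N β h), ?_, fun ω hω R hR => ?_⟩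
  · refine (measure_iUnion_fintype_le _ _).trans ?_
    calc _ ≤ ∑ _h : Fin H, 2 *
          ENNReal.ofReal (d * (2 * Real.exp (-(2 * t ^ 2 / (H : ℝ) ^ 2)))) :=
        Finset.sum_le_sum fun h _ => (measure_union_le _ _).trans (by
          rw [two_mul]; exact add_le_add (hNle _ h) (hNle _ h))
      _ = _ := by
        generalize (d * (2 * Real.exp (-(2 * t ^ 2 / (H : ℝ) ^ 2))) : ℝ) = E
        rw [Finset.sum_const, Finset.card_univ, Fintype.card_fin, nsmul_eq_mul,
          ENNReal.ofReal_mul (Nat.cast_nonneg _), ENNReal.ofReal_natCast,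
          ENNReal.ofReal_mul two_pos.le, ENNReal.ofReal_ofNat]
  · simp only [Set.mem_iUnion, Set.mem_union, not_exists, not_or, hN, Set.mem_ofPred_eq,
      not_lt] at hω
    have hlo : ∀ h : Fin (H + 1), R.loV h = V (-β) h ω :=
      fun h => hVeq _ h ω _ hR.isValueEstimate_loV
    have hup : ∀ h : Fin (H + 1), R.upV h = V β h ω :=
      fun h => hVeq _ h ω _ hR.isValueEstimate_upV
    have hmV : ∀ β h, Measurable (V β h ω) := fun β h => (hVm β h).comp measurable_prodMk_left
    have hmlo : ∀ h ≤ H, Measurable (R.loV h) := fun h hh => by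
      rw [show R.loV h = _ from hlo ⟨h, Nat.lt_succ_of_le hh⟩]; exact hmV _ _
    have hmup : ∀ h ≤ H, Measurable (R.upV h) := fun h hh => by
      rw [show R.upV h = _ from hup ⟨h, Nat.lt_succ_of_le hh⟩]; exact hmV _ _
    refine ⟨hR, hmlo, hmup, fun h => ?_, fun h => ?_⟩
    · refine hG.isAccurate fold h (hmlo _ h.2)
        (hR.isValueEstimate_loV.mem_Icc (h := h + 1) h.2) ω ?_ hβ
      rw [show R.loV (h + 1) = _ from hlo h.succ]
      exact (hω h).1
    · refine hG.isAccurate fold h (hmup _ h.2)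
        (hR.isValueEstimate_upV.mem_Icc (h := h + 1) h.2) ω ?_ hβ
      rw [show R.upV (h + 1) = _ from hup h.succ]
      exact (hω h).2

end Main

end

theorem mainTheorem6 :
    ∃ c₀ : ℝ, 0 < c₀ ∧ ∀ c : ℝ, c₀ ≤ c → ∃ C : ℝ, 0 < C ∧
      ∀ (S : Type*) (A : Type*) (B : Type*) [MeasurableSpace S]
        [Fintype A] [MeasurableSpace A] [MeasurableSingletonClass A]
        [Fintype B] [MeasurableSpace B] [MeasurableSingletonClass B]
        (d H K : ℕ) (G : MarkovGame S A B) (φ : S × A × B → EuclideanSpace ℝ (Fin d))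
        (ρ : Measure S) [IsProbabilityMeasure ρ] (b : Policy S (A × B))
        (fold : Fin K → Fin H) (δ : ℝ) (πStar : Policy S A) (νStar : Policy S B),
        1 ≤ H → 1 ≤ K →
        (∀ h : Fin H, H * (Finset.univ.filter fun τ => fold τ = h).card = K) →
        0 < δ → δ < 1 →
        G.IsLinear H φ →
        G.IsNash H πStar νStar →
        G.dataLaw ρ b H K
          {ω | ¬ ∀ R : SPMVIRun S A B,
            R.IsRunOn φ fold 1 (c * √d * H * √(logFactor d H K δ)) (G.observe ω) →
            (∀ x : S, G.gap H R.πHat R.νHat x ≤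
              C * √d * H * √(logFactor d H K δ) *
                ((⨆ ν : Policy S B,
                    G.uncertainty φ (gram φ fold 1 (G.observe ω)) πStar ν x) +
                 (⨆ π : Policy S A,
                    G.uncertainty φ (gram φ fold 1 (G.observe ω)) π νStar x))) ∧
            (0 < G.coverage ρ b H φ →
              ∀ h < H, ∀ x : S,
                |G.value H πStar νStar h x - R.upV h x| ≤
                  C * √(logFactor d H K δ) *
                    ((H : ℝ) ^ (5 / 2 : ℝ) * √d / √(K * G.coverage ρ b H φ)) ∧
                |G.value H πStar νStar h x - R.loV h x| ≤
                  C * √(logFactor d H K δ) *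
                    ((H : ℝ) ^ (5 / 2 : ℝ) * √d / √(K * G.coverage ρ b H φ)))}
          ≤ ENNReal.ofReal δ := by
  -- Noise and bias require `β ≥ 2 √d H √ι + √d H`, and `√ι ≥ 1 / 2` makes `c ≥ 4` enough. In `C`,
  -- the term `12 c` covers `2 c` for the gap and `2 c √32` for the rate; `16 = √256` handles small
  -- `n κ`.
  refine ⟨4, by norm_num, fun c hc => ⟨12 * c + 16, by linarith, ?_⟩⟩
  intro S A B _ _ _ _ _ _ _ d H K G φ ρ _ b fold δ πStar νStar hH hK hfold hδ hδ1 hG hN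
  -- Nonemptiness is not assumed; it follows from the existence of `ρ` and `b`, and it gives `d ≥
  -- 1`.
  obtain ⟨x₀⟩ : Nonempty S := nonempty_of_isProbabilityMeasure ρ
  obtain ⟨a₀, b₀⟩ : Nonempty (A × B) := nonempty_of_isProbabilityMeasure (b.kernel 0 x₀)
  have : Nonempty A := ⟨a₀⟩
  have : Nonempty B := ⟨b₀⟩
  have hd : 1 ≤ d := hG.one_le_dim hH (x₀, a₀, b₀)
  obtain ⟨n, hnK⟩ : ∃ n, H * n = K := ⟨_, hfold ⟨0, hH⟩⟩
  have hcard : ∀ h : Fin H, (Finset.univ.filter fun τ => fold τ = h).card = n := fun h =>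
    Nat.eq_of_mul_eq_mul_left hH ((hfold h).trans hnK.symm)
  have hn : 0 < n := Nat.pos_of_ne_zero fun h => by subst h; omega
  have hnK' : n ≤ K := hnK ▸ Nat.le_mul_of_pos_left n hH
  have hι := half_le_sqrt_logFactor hd hH hK hδ hδ1
  have hι0 : 0 < logFactor d H K δ := by linarith [half_le_logFactor hd hH hK hδ hδ1]
  have hcov := fun hκ : 256 * d * logFactor d H K δ ≤ n * G.coverage ρ b H φ =>
    coverage_failure_le hd hH hK hnK' hδ hδ1 hκ
  have hnoise := noise_failure_le hd hH hK hδ hδ1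
  set ι := logFactor d H K δ with hιdef
  set κ := G.coverage ρ b H φ with hκdef
  have hβ : √d * (2 * H * √ι) + √d * H ≤ c * √d * H * √ι := by
    have h1 : 0 ≤ √d * H := by positivity
    nlinarith [mul_le_mul_of_nonneg_left hι h1,
      mul_le_mul_of_nonneg_right hc (mul_nonneg h1 (Real.sqrt_nonneg ι))]
  have hβ0 : 0 ≤ c * √d * H * √ι := le_trans (by positivity) hβ
  obtain ⟨N, hNle, hNgood⟩ := MarkovGame.exists_good_event hG ρ b fold
    (by positivity : 0 ≤ 2 * H * √ι) hβ
  obtain ⟨N', hN'le, hN'good⟩ : ∃ N' : Set (Fin K → Fin H → Transition S A B),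
      G.dataLaw ρ b H K N' ≤ ENNReal.ofReal (δ / 2) ∧
      (0 < κ → 256 * d * ι ≤ n * κ → ∀ ω ∉ N', ∀ h : Fin H, ∀ v : Fin d → ℝ,
        n * κ / 32 * (v ⬝ᵥ v) ≤ v ⬝ᵥ (gram φ fold 1 (G.observe ω) h).mulVec v) := by
    by_cases hκ : 0 < κ ∧ 256 * d * ι ≤ n * κ
    · refine ⟨⋃ h : Fin H, {ω | ¬ ∀ v : Fin d → ℝ, n * κ / 32 * (v ⬝ᵥ v) ≤
        v ⬝ᵥ (gram φ fold 1 (G.observe ω) h).mulVec v}, ?_, fun _ _ ω hω h => ?_⟩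
      · refine (measure_iUnion_fintype_le _ _).trans ?_
        calc _ ≤ ∑ _h : Fin H, ENNReal.ofReal ((4 * d * n + 1) ^ d * Real.exp (-(n * κ / 64))) :=
              Finset.sum_le_sum fun h _ =>
                G.measure_gram_lt_le ρ b hG.measurable hG.norm_le fold h (hcard h) hn hκ.1
          _ = ENNReal.ofReal (H * ((4 * d * n + 1) ^ d * Real.exp (-(n * κ / 64)))) := by
              rw [Finset.sum_const, Finset.card_univ, Fintype.card_fin, nsmul_eq_mul,
                ENNReal.ofReal_mul (p := (H : ℝ)) (Nat.cast_nonneg _), ENNReal.ofReal_natCast]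
          _ ≤ _ := ENNReal.ofReal_le_ofReal (hcov hκ.2)
      · simp only [Set.mem_iUnion, not_exists, Set.mem_ofPred_eq, not_not] at hω
        exact hω h
    -- Without enough coverage no further event is needed.
    · exact ⟨∅, by simp, fun h1 h2 => absurd ⟨h1, h2⟩ hκ⟩
  -- Monotonicity of the outer measure suffices, so the failure set, which quantifies over all runs,
  -- need not be measurable.
  refine (measure_mono (t := N ∪ N') fun ω hω => ?_).trans ?_
  · by_contra hcon
    rw [Set.mem_union, not_or] at hcon
    refine hω fun R hR => ?_
    have hgood := hNgood ω hcon.1 R hR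
    refine ⟨fun x => (hgood.gap_le hG.measurable hG.norm_le hβ0 hH hN x).trans ?_,
      fun hκ h hh x => ?_⟩
    · refine mul_le_mul_of_nonneg_right ?_ (add_nonneg ?_ ?_)
      · have h1 : 0 ≤ √d * H * √ι := by positivity
        nlinarith
      · exact Real.iSup_nonneg fun ν => Finset.sum_nonneg fun h _ =>
          integral_nonneg fun ω => matNorm_nonneg _ _
      · exact Real.iSup_nonneg fun π => Finset.sum_nonneg fun h _ =>
          integral_nonneg fun ω => matNorm_nonneg _ _
    · by_cases hreg : 256 * d * ι ≤ n * κ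
      · have hα : 0 < n * κ / 32 := by positivity
        have h1 := hgood.abs_value_sub_le hG.measurable hG.norm_le hβ0 hN (by positivity)
          (fun h z => matNorm_gram_inv_le_of_le hG.norm_le hα
            (hN'good hκ hreg ω hcon.2 h) z) hh x
        have h2 := bonus_rate_le (d := d) (ι := ι) hH hnK hn hκ (by linarith : 0 ≤ c)
        exact ⟨h1.1.trans h2, h1.2.trans h2⟩
      · have h1 := hgood.abs_value_sub_le_horizon (πStar := πStar) (νStar := νStar) hh x
        have h2 := horizon_le_rate hd hH hnK hn hκ (by linarith : 0 ≤ c) hι0 (not_le.mp hreg)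
        exact ⟨h1.1.trans h2, h1.2.trans h2⟩
  · refine (measure_union_le _ _).trans ?_
    refine (add_le_add (hNle.trans (ENNReal.ofReal_le_ofReal hnoise)) hN'le).trans ?_
    rw [← ENNReal.ofReal_add (by positivity) (by positivity), add_halves]
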